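/- Let $\varphi_n(x)=(\sqrt\pi\,2^n n!)^{-1/2}e^{-x^2/2}H_n(x)$, $n\ge 0$, be the Hermite functions ($H_n$ the physicists' Hermite polynomials), and let $K_{\mathrm H}^N$ be the integral operator on $L^2(\mathbb R)$ with kernel $\sum_{n=0}^{N-1}\varphi_n(x)\varphi_n(y)$. For $r\in\mathbb R$ put $\chi_rf(x)=\mathbf 1_{x>r}f(x)$, $\bar\chi_r=I-\chi_r$, $\varrho_rf(x)=f(2r-x)$ and $E_rf(x)=e^{rx}f(x)$. For $a>-1$ let $\psi_k^{(a)}(x)=\big(\tfrac{k!}{\Gamma(k+a+1)}\big)^{1/2}x^{a/2}e^{-x/2}L_k^{(a)}(x)\mathbf 1_{x\ge 0}$ be the generalized Laguerre functions, normalized in $L^2(\mathbb R)$ ($L_k^{(a)}$ the generalized Laguerre polynomials), and let $K_{\mathrm L}^{m,(a)}$ be the integral operator on $L^2(\mathbb R)$ with kernel $\sum_{k=0}^{m-1}\psi_k^{(a)}(x)\psi_k^{(a)}(y)$. Let $\det$ denote the Fredholm determinant on $L^2(\mathbb R)$. **Proposition 3.1.** For every $N\in\mathbb N$ and every $r\ge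 0$, with $m=\lfloor (N+1)/2\rfloor$ and $a=\tfrac12(-1)^N$, $$\det\!\big(I-K_{\mathrm H}^N\chi_rK_{\mathrm H}^N-K_{\mathrm H}^NE_{-r}\varrho_rE_r\bar\chi_rK_{\mathrm H}^N\big)=\det\!\big(I-K_{\mathrm L}^{m,(a)}\chi_{r^2}K_{\mathrm L}^{m,(a)}\big).$$ -/

import Mathlib

open MeasureTheory Set

noncomputable section

/-! ### Trace class operators and the Fredholm determinant -/

/-- `A` is a trace class (nuclear) operator on the real Hilbert space `E`: it is a sum of
rank one operators `x ↦ ⟪u n, x⟫ v n` with `∑ ‖u n‖ ‖v n‖ < ∞`. -/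
def IsTraceClass {E : Type*} [NormedAddCommGroup E] [InnerProductSpace ℝ E]
    (A : E →L[ℝ] E) : Prop :=
  ∃ u v : ℕ → E, Summable (fun n => ‖u n‖ * ‖v n‖) ∧
    ∀ x : E, HasSum (fun n => inner ℝ (u n) x • v n) (A x)

open Classical in
/-- The principal minor of the infinite matrix `(⟪b i, A (b j)⟫)` on the finite index set `S`. It is
the diagonal entry of the exterior power `Λᵏ A`, `k = #S`, at the basis vector `⋀_{i ∈ S} b i`. -/
def principalMinor {E : Type*} [NormedAddCommGroup E] [InnerProductSpace ℝ E]
    {ι : Type*} (b : HilbertBasis ι ℝ E) (A : E →L[ℝ] E) (S : Finset ι) : ℝ :=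
  Matrix.det (Matrix.of fun i j : S => inner ℝ (b i) (A (b j)))

/-- `HasFredholmDet B d`: the operator `B` is of the form `I + A` with `A` trace class, and its
Fredholm determinant `det (I + A) = ∑ₖ tr (Λᵏ A)` is `d`. The traces are written out in an
orthonormal basis, `tr (Λᵏ A) = ∑_{#S = k} det (⟪b i, A (b j)⟫)_{i, j ∈ S}`, and the (absolutely
convergent) series is required to have the sum `d` in every orthonormal basis. -/
def HasFredholmDet.{u} {E : Type u} [NormedAddCommGroup E] [InnerProductSpace ℝ E]
    (B : E →L[ℝ] E) (d : ℝ) : Prop :=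
  IsTraceClass (B - 1) ∧
    ∀ (ι : Type u) (b : HilbertBasis ι ℝ E), HasSum (principalMinor b (B - 1)) d

/-! ### Operators on `L²(ℝ)` -/

/-- The Hilbert space `L²(ℝ)` (Lebesgue measure, real valued functions). -/
abbrev L2R : Type := Lp ℝ 2 (volume : Measure ℝ)

/-- The operator on `L²(ℝ)` induced by a linear map on functions that does not increase
the `L²` norm. -/
def contractionOp (T : (ℝ → ℝ) →ₗ[ℝ] (ℝ → ℝ))
    (hT : ∀ f : ℝ → ℝ, MemLp f 2 → MemLp (T f) 2 ∧ eLpNorm (T f) 2 volume ≤ eLpNorm f 2 volume) :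
    L2R →L[ℝ] L2R :=
  have key : ∀ f g : ℝ → ℝ, MemLp f 2 → MemLp g 2 → f =ᵐ[volume] g → T f =ᵐ[volume] T g := by
    intro f g hf hg hfg
    have h1 := hT (f - g) (hf.sub hg)
    have h0 : eLpNorm (f - g) 2 volume = 0 := by
      rw [eLpNorm_eq_zero_iff (hf.sub hg).1 (by norm_num)]
      filter_upwards [hfg] with x hx
      simp [hx]
    have h2 : eLpNorm (T (f - g)) 2 volume = 0 := le_antisymm (h0 ▸ h1.2) zero_le
    rw [eLpNorm_eq_zero_iff h1.1.1 (by norm_num)] at h2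
    filter_upwards [h2] with x hx
    simpa [sub_eq_zero] using hx
  LinearMap.mkContinuous
    { toFun := fun f => (hT f (Lp.memLp f)).1.toLp (T f)
      map_add' := fun f g => by
        rw [← MemLp.toLp_add]
        refine MemLp.toLp_congr _ _ ?_
        rw [← map_add]
        exact key _ _ (Lp.memLp _) ((Lp.memLp f).add (Lp.memLp g)) (Lp.coeFn_add f g)
      map_smul' := fun c f => by
        rw [RingHom.id_apply, ← MemLp.toLp_const_smul]
        refine MemLp.toLp_congr _ _ ?_
        rw [← map_smul]
        exact key _ _ (Lp.memLp _) ((Lp.memLp f).const_smul c) (Lp.coeFn_smul c f) }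
    1 (fun f => by
      rw [one_mul]
      simp only [LinearMap.coe_mk, AddHom.coe_mk, Lp.norm_toLp]
      rw [Lp.norm_def]
      exact ENNReal.toReal_mono (Lp.memLp f).2.ne (hT f (Lp.memLp f)).2)

theorem contractionOp_apply (T : (ℝ → ℝ) →ₗ[ℝ] (ℝ → ℝ))
    (hT : ∀ f : ℝ → ℝ, MemLp f 2 → MemLp (T f) 2 ∧ eLpNorm (T f) 2 volume ≤ eLpNorm f 2 volume)
    (f : L2R) : contractionOp T hT f =ᵐ[volume] T f :=
  (hT f (Lp.memLp f)).1.coeFn_toLp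

/-- `χ_r f (x) = 1_{x > r} f (x)`. -/
def chiFun (r : ℝ) : (ℝ → ℝ) →ₗ[ℝ] (ℝ → ℝ) where
  toFun f := (Ioi r).indicator f
  map_add' f g := indicator_add _ f g
  map_smul' c f := indicator_const_smul _ c f

/-- `χ̄_r = I - χ_r`. -/
def chiBarFun (r : ℝ) : (ℝ → ℝ) →ₗ[ℝ] (ℝ → ℝ) := LinearMap.id - chiFun r

/-- `ϱ_r f (x) = f (2 r - x)`. -/
def reflFun (r : ℝ) : (ℝ → ℝ) →ₗ[ℝ] (ℝ → ℝ) where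
  toFun f := fun x => f (2 * r - x)
  map_add' _ _ := rfl
  map_smul' _ _ := rfl

/-- `E_r f (x) = e^{r x} f (x)`. -/
def expMulFun (r : ℝ) : (ℝ → ℝ) →ₗ[ℝ] (ℝ → ℝ) where
  toFun f := fun x => Real.exp (r * x) * f x
  map_add' f g := by ext x; simp [mul_add]
  map_smul' c f := by ext x; simp [mul_left_comm]

theorem chiFun_contraction (r : ℝ) (f : ℝ → ℝ) (hf : MemLp f 2) :
    MemLp (chiFun r f) 2 ∧ eLpNorm (chiFun r f) 2 volume ≤ eLpNorm f 2 volume :=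
  ⟨hf.indicator measurableSet_Ioi, eLpNorm_indicator_le f⟩

/-- `χ_r` as an operator on `L²(ℝ)`. -/
def chiOp (r : ℝ) : L2R →L[ℝ] L2R := contractionOp (chiFun r) (chiFun_contraction r)

/-- The composition `E_{-r} ϱ_r E_r χ̄_r`. -/
def reflectedFun (r : ℝ) : (ℝ → ℝ) →ₗ[ℝ] (ℝ → ℝ) :=
  expMulFun (-r) ∘ₗ reflFun r ∘ₗ expMulFun r ∘ₗ chiBarFun r

theorem reflectedFun_contraction (r : ℝ) (hr : 0 ≤ r) (f : ℝ → ℝ) (hf : MemLp f 2) :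
    MemLp (reflectedFun r f) 2 ∧
      eLpNorm (reflectedFun r f) 2 volume ≤ eLpNorm f 2 volume := by
  have hmp : MeasurePreserving (fun x : ℝ => 2 * r - x) volume volume :=
    Measure.measurePreserving_sub_left volume (2 * r)
  have hg : MemLp (fun x => f (2 * r - x)) 2 := hf.comp_measurePreserving hmp
  have heq : reflectedFun r f = fun x =>
      Real.exp (-r * x) * (Real.exp (r * (2 * r - x)) *
        (Ici r).indicator (fun y => f (2 * r - y)) x) := by
    funext x
    by_cases hx : r ≤ x
    · have : ¬ (r < 2 * r - x) := by linarith
      simp [reflectedFun, expMulFun, reflFun, chiBarFun, chiFun, indicator, hx, this]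
    · have : r < 2 * r - x := by linarith
      simp [reflectedFun, expMulFun, reflFun, chiBarFun, chiFun, indicator, hx, this]
  have hm : AEStronglyMeasurable (reflectedFun r f) volume := by
    rw [heq]
    refine AEStronglyMeasurable.mul (by fun_prop) (AEStronglyMeasurable.mul (by fun_prop) ?_)
    exact hg.1.indicator measurableSet_Ici
  have hb : ∀ x, ‖reflectedFun r f x‖ ≤ ‖f (2 * r - x)‖ := by
    intro x
    rw [heq]
    by_cases hx : r ≤ x
    · have h1 : Real.exp (-r * x) * Real.exp (r * (2 * r - x)) ≤ 1 := by
        rw [← Real.exp_add, Real.exp_le_one_iff]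
        nlinarith
      simp only [indicator, mem_Ici, hx, if_true, ← mul_assoc]
      rw [norm_mul, Real.norm_of_nonneg (by positivity)]
      exact mul_le_of_le_one_left (norm_nonneg _) h1
    · simp [indicator, hx]
  refine ⟨hg.of_le hm (Filter.Eventually.of_forall hb), (eLpNorm_mono hb).trans ?_⟩
  exact (eLpNorm_comp_measurePreserving hf.1 hmp).le

/-- `E_{-r} ϱ_r E_r χ̄_r` as an operator on `L²(ℝ)` (it is bounded for `r ≥ 0`, although `E_r`
is not). -/
def reflectedOp (r : ℝ) (hr : 0 ≤ r) : L2R →L[ℝ] L2R :=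
  contractionOp (reflectedFun r) (reflectedFun_contraction r hr)

/-- The integral operator on `L²(ℝ)` with kernel `(x, y) ↦ ∑_{k < n} f k x * f k y`. -/
def kernelOp (f : ℕ → ℝ → ℝ) (hf : ∀ k, MemLp (f k) 2) (n : ℕ) : L2R →L[ℝ] L2R :=
  ∑ k ∈ Finset.range n,
    InnerProductSpace.rankOne ℝ ((hf k).toLp (f k)) ((hf k).toLp (f k))

theorem kernelOp_apply (f : ℕ → ℝ → ℝ) (hf : ∀ k, MemLp (f k) 2) (n : ℕ) (g : L2R) :
    kernelOp f hf n g =ᵐ[volume]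
      fun x => ∫ y, (∑ k ∈ Finset.range n, f k x * f k y) * g y := by
  have hint : ∀ k, Integrable (fun y => f k y * g y) := fun k =>
    (hf k).integrable_mul (Lp.memLp g)
  have hin : ∀ k, inner ℝ ((hf k).toLp (f k)) g = ∫ y, f k y * g y := by
    intro k
    rw [L2.inner_def]
    refine integral_congr_ae ?_
    filter_upwards [(hf k).coeFn_toLp] with y hy
    simp [hy, mul_comm]
  have hcoe : kernelOp f hf n g =ᵐ[volume]
      fun x => ∑ k ∈ Finset.range n, (∫ y, f k y * g y) * f k x := by
    induction n with
    | zero =>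
      simp only [kernelOp, Finset.range_zero, Finset.sum_empty]
      exact Lp.coeFn_zero _ _ _
    | succ n ih =>
      have hs : kernelOp f hf (n + 1) g =
          kernelOp f hf n g + (∫ y, f n y * g y) • (hf n).toLp (f n) := by
        simp only [kernelOp, Finset.sum_range_succ, add_apply,
          InnerProductSpace.rankOne_apply, hin]
      rw [hs]
      filter_upwards [ih, Lp.coeFn_add (kernelOp f hf n g) ((∫ y, f n y * g y) • (hf n).toLp (f n)),
        Lp.coeFn_smul (∫ y, f n y * g y) ((hf n).toLp (f n)), (hf n).coeFn_toLp]
        with x h1 h2 h3 h4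
      rw [h2, Pi.add_apply, h1, h3, Finset.sum_range_succ, Pi.smul_apply, h4, smul_eq_mul]
  refine hcoe.trans (Filter.Eventually.of_forall fun x => ?_)
  simp only [Finset.sum_mul, mul_assoc]
  rw [integral_finsetSum _ (fun k _ => (hint k).const_mul _)]
  exact Finset.sum_congr rfl fun k _ => by rw [integral_const_mul, mul_comm]

/-! ### Hermite functions and the Hermite kernel -/

/-- The physicists' Hermite polynomials: `H₀ = 1`, `H_{n+1} = 2 x H_n - H_n'`. -/
def hermiteH : ℕ → Polynomial ℝ
  | 0 => 1
  | n + 1 => 2 * Polynomial.X * hermiteH n - Polynomial.derivative (hermiteH n)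

/-- The Hermite functions `φ_n (x) = (√π 2ⁿ n!)^{-1/2} e^{-x²/2} H_n (x)`. -/
def hermiteFun (n : ℕ) (x : ℝ) : ℝ :=
  (Real.sqrt (Real.sqrt Real.pi * 2 ^ n * n.factorial))⁻¹ *
    (Real.exp (-(x ^ 2) / 2) * (hermiteH n).eval x)

theorem memLp_hermiteFun (n : ℕ) : MemLp (hermiteFun n) 2 := by
  have hP : ∀ P : Polynomial ℝ, Integrable (fun x : ℝ => Real.exp (-(x ^ 2)) * P.eval x) := by
    intro P
    induction P using Polynomial.induction_on' with
    | add p q hp hq =>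
      refine (hp.add hq).congr (Filter.Eventually.of_forall fun x => ?_)
      simp [mul_add]
    | monomial k c =>
      have h := integrable_rpow_mul_exp_neg_mul_sq (b := 1) one_pos (s := (k : ℝ))
        (by have : (0 : ℝ) ≤ k := k.cast_nonneg
            linarith)
      refine (h.const_mul c).congr (Filter.Eventually.of_forall fun x => ?_)
      simp [Real.rpow_natCast]
      ring
  have hm : Continuous (fun x : ℝ => Real.exp (-(x ^ 2) / 2) * (hermiteH n).eval x) := by
    fun_prop
  refine MemLp.const_mul ?_ _
  rw [memLp_two_iff_integrable_sq hm.aestronglyMeasurable]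
  refine (hP (hermiteH n ^ 2)).congr (Filter.Eventually.of_forall fun x => ?_)
  simp only [Polynomial.eval_pow, mul_pow, ← Real.exp_nat_mul]
  congr 2
  push_cast
  ring

/-- The Hermite kernel operator `K_H^N`, with kernel `∑_{n < N} φ_n (x) φ_n (y)`. -/
def hermiteOp (N : ℕ) : L2R →L[ℝ] L2R := kernelOp hermiteFun memLp_hermiteFun N

/-! ### Generalized Laguerre functions and the Laguerre kernel -/

/-- The generalized Laguerre polynomial
`L_n^{(a)} (x) = ∑_{k ≤ n} (a+k+1)(a+k+2)⋯(a+n) / ((n-k)! k!) (-x)^k`. -/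
def laguerreL (a : ℝ) (n : ℕ) : Polynomial ℝ :=
  ∑ k ∈ Finset.range (n + 1),
    Polynomial.C ((∏ i ∈ Finset.Ioc k n, (a + i)) / ((n - k).factorial * k.factorial)) *
      (-Polynomial.X) ^ k

/-- The generalized Laguerre functions
`ψ_k^{(a)} (x) = (k! / Γ(k+a+1))^{1/2} x^{a/2} e^{-x/2} L_k^{(a)} (x) 1_{x ≥ 0}`, of norm one in
`L²(ℝ)`. -/
def laguerreFun (a : ℝ) (k : ℕ) (x : ℝ) : ℝ :=
  Real.sqrt (k.factorial / Real.Gamma (k + a + 1)) *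
    (Ici (0 : ℝ)).indicator
      (fun x => x ^ (a / 2) * Real.exp (-x / 2) * (laguerreL a k).eval x) x

theorem memLp_laguerreFun (a : ℝ) (ha : -1 < a) (k : ℕ) : MemLp (laguerreFun a k) 2 := by
  have hP : ∀ P : Polynomial ℝ,
      IntegrableOn (fun x : ℝ => x ^ a * Real.exp (-x) * P.eval x) (Ioi 0) := by
    intro P
    induction P using Polynomial.induction_on' with
    | add p q hp hq =>
      refine IntegrableOn.congr_fun (hp.add hq) (fun x _ => ?_) measurableSet_Ioi
      simp [mul_add]
    | monomial j c =>
      have h := Real.GammaIntegral_convergent (s := a + j + 1)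
        (by have : (0 : ℝ) ≤ j := j.cast_nonneg
            linarith)
      refine IntegrableOn.congr_fun (h.const_mul c) (fun x hx => ?_) measurableSet_Ioi
      have hx : 0 < x := hx
      simp only [Polynomial.eval_monomial, add_sub_cancel_right, Real.rpow_add hx,
        Real.rpow_natCast]
      ring
  refine MemLp.const_mul ?_ _
  rw [memLp_indicator_iff_restrict measurableSet_Ici, memLp_two_iff_integrable_sq]
  · change IntegrableOn _ (Ici 0) volume
    rw [integrableOn_Ici_iff_integrableOn_Ioi]
    refine (hP (laguerreL a k ^ 2)).congr_fun (fun x hx => ?_) measurableSet_Ioi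
    have hx : 0 < x := hx
    simp only [Polynomial.eval_pow, mul_pow, ← Real.exp_nat_mul]
    rw [← Real.rpow_natCast (x ^ (a / 2)), ← Real.rpow_mul hx.le]
    congr 3
    · push_cast
      ring
    · push_cast
      ring
  · exact ((by fun_prop : Measurable fun x : ℝ =>
      x ^ (a / 2) * Real.exp (-x / 2)).mul (by fun_prop)).aestronglyMeasurable

/-- The Laguerre kernel operator `K_L^{m,(a)}`, with kernel `∑_{k < m} ψ_k^{(a)} (x) ψ_k^{(a)} (y)`,
for a parameter `a > -1`. -/
def laguerreOp (m : ℕ) (a : ℝ) (ha : -1 < a) : L2R →L[ℝ] L2R :=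
  kernelOp (laguerreFun a) (memLp_laguerreFun a ha) m

theorem neg_one_lt_half_neg_one_pow (N : ℕ) : (-1 : ℝ) < 1 / 2 * (-1) ^ N := by
  rcases neg_one_pow_eq_or ℝ N with h | h <;> rw [h] <;> norm_num

end

open Polynomial

noncomputable section

/-! ### The Fredholm determinant of a finite rank perturbation of the identity -/

/-! Both operators are finite rank perturbations of the identity, so both Fredholm determinants are
finite determinants (`hasFredholmDet_one_sub_kernelOp`). With `w = e^{-x²}`, the Hermite side is the
determinant of `reflectedForm r` in the orthonormal Hermite polynomials of degree below `N`. The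
substitution `x = u²` turns the Laguerre functions with `a = ±1/2` into Hermite functions of one
parity, so the Laguerre side is the determinant of `(P, Q) ↦ ∫ sgn(r - x) P Q w` on polynomials of
the parity of `N - 1`.

The two are compared in `det_reflectedForm_eq` by choosing other bases. On the right, `(X - r)^l` is
an eigenvector of the reflection `x ↦ 2r - x`: the reflected form becomes the plain Gauss moment for
odd `l` and the signed moment for even `l`. On the left stand truncations of `e^{2xr - r²} H_n(x -
r)`, which times `w` is the translate of `w H_n` by `r`. Pairings with these bases are given by
`IsGaussFamily.truncTranslate_mul_eq`: both sides have the same derivative in `r` and agree at `r =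
0`.

The Gauss moments then do not depend on `r` and vanish for mixed parity, so the matrix of the
reflected form is block triangular. Its odd block is that of the Gauss moments and cancels against
the Gram determinant; its even block is the signed form on polynomials of the parity of `N - 1`. -/

theorem sum_det_principal_submatrix {n : Type*} [Fintype n] [DecidableEq n] (M : Matrix n n ℝ) :
    ∑ s : Finset n, (M.submatrix (Subtype.val : s → n) Subtype.val).det = (1 + M).det := by
  have h := (Matrix.detRowAlternating : (n → ℝ) [⋀^n]→ₗ[ℝ] ℝ).map_add_univ M.row
    (1 : Matrix n n ℝ).row
  rw [add_comm]
  refine Eq.trans ?_ h.symm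
  exact Finset.sum_congr rfl fun s _ => (Matrix.det_piecewise_one_eq_submatrix_det M s).symm

theorem sum_powerset_det_principal_submatrix {ι : Type*} [DecidableEq ι] (M : Matrix ι ι ℝ)
    (F : Finset ι) :
    ∑ S ∈ F.powerset, (M.submatrix (Subtype.val : S → ι) Subtype.val).det =
      (1 + M.submatrix (Subtype.val : F → ι) Subtype.val).det := by
  rw [← sum_det_principal_submatrix]
  symm
  refine Finset.sum_bij' (fun s _ => s.map (Function.Embedding.subtype _))
    (fun S _ => S.subtype (· ∈ F)) ?_ ?_ ?_ ?_ ?_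
  · intro s _
    rw [Finset.mem_powerset]
    intro i hi
    obtain ⟨j, -, rfl⟩ := Finset.mem_map.1 hi
    exact j.2
  · simp
  · intro s _
    ext i
    simp
  · intro S hS
    ext i
    simp only [Finset.mem_map, Finset.mem_subtype, Function.Embedding.subtype_apply,
      Subtype.exists, exists_and_left, exists_prop, exists_eq_right_right]
    exact ⟨fun h => h.1, fun h => ⟨h, Finset.mem_powerset.1 hS h⟩⟩
  · intro s _
    let e : s ≃ (s.map (Function.Embedding.subtype (· ∈ F)) : Finset ι) :=
      { toFun := fun i => ⟨i.1.1, Finset.mem_map.2 ⟨i.1, i.2, rfl⟩⟩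
        invFun := fun j => ⟨⟨j.1, (Finset.mem_map.1 j.2).elim fun k hk => hk.2 ▸ k.2⟩,
          (Finset.mem_map.1 j.2).elim fun k hk => by
            have : k = ⟨j.1, hk.2 ▸ k.2⟩ := Subtype.ext hk.2
            exact this ▸ hk.1⟩
        left_inv := fun _ => rfl
        right_inv := fun _ => rfl }
    rw [← Matrix.det_submatrix_equiv_self e]
    rfl

/-- Every term of the Leibniz formula has the same bound, since a permutation only reorders the
factors `a`. -/
theorem abs_det_le_of_abs_le_mul {n : Type*} [Fintype n] [DecidableEq n] (M : Matrix n n ℝ)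
    (a c : n → ℝ) (h : ∀ i j, |M i j| ≤ a i * c j) :
    |M.det| ≤ (Fintype.card n).factorial * ∏ i, (a i * c i) := by
  rw [Matrix.det_apply']
  refine (Finset.abs_sum_le_sum_abs _ _).trans ?_
  have : ∀ σ ∈ (Finset.univ : Finset (Equiv.Perm n)),
      |((Equiv.Perm.sign σ : ℤ) : ℝ) * ∏ i, M (σ i) i| ≤ ∏ i, (a i * c i) := by
    intro σ _
    rw [abs_mul, Finset.abs_prod]
    have h1 : |((Equiv.Perm.sign σ : ℤ) : ℝ)| = 1 := by
      rcases Int.units_eq_one_or (Equiv.Perm.sign σ) with h | h <;> simp [h]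
    rw [h1, one_mul]
    calc ∏ i, |M (σ i) i| ≤ ∏ i, (a (σ i) * c i) :=
          Finset.prod_le_prod (fun i _ => abs_nonneg _) fun i _ => h _ _
      _ = ∏ i, (a i * c i) := by
          rw [Finset.prod_mul_distrib, Finset.prod_mul_distrib, Equiv.prod_comp σ a]
  refine (Finset.sum_le_card_nsmul _ _ _ this).trans_eq ?_
  simp [Finset.card_univ, Fintype.card_perm]

theorem det_mul_eq_zero_of_card_lt {m n : Type*} [Fintype m] [DecidableEq m] [Fintype n]
    (A : Matrix m n ℝ) (B : Matrix n m ℝ) (h : Fintype.card n < Fintype.card m) :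
    (A * B).det = 0 := by
  by_contra h0
  have h1 : IsUnit (A * B) := by
    rw [Matrix.isUnit_iff_isUnit_det]
    exact isUnit_iff_ne_zero.2 h0
  have h2 := Matrix.rank_of_isUnit _ h1
  have h3 := (Matrix.rank_mul_le_left A B).trans (Matrix.rank_le_card_width A)
  omega

section FiniteRank

variable {E : Type*} [NormedAddCommGroup E] [InnerProductSpace ℝ E]

theorem isTraceClass_sum_inner_smul {n : ℕ} (u v : Fin n → E) (A : E →L[ℝ] E)
    (hA : ∀ x, A x = ∑ k, inner ℝ (u k) x • v k) : IsTraceClass A := by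
  refine ⟨fun k => if h : k < n then u ⟨k, h⟩ else 0, fun k => if h : k < n then v ⟨k, h⟩ else 0,
    ?_, fun x => ?_⟩
  · refine summable_of_ne_finset_zero (s := Finset.range n) fun k hk => ?_
    simp [(by simpa using hk : ¬ k < n)]
  · have h := hasSum_sum_of_ne_finset_zero (s := Finset.range n)
      (L := SummationFilter.unconditional ℕ)
      (f := fun k => inner ℝ (if h : k < n then u ⟨k, h⟩ else 0) x •
        (if h : k < n then v ⟨k, h⟩ else 0)) (fun k hk => by
          simp [(by simpa using hk : ¬ k < n)])
    convert h using 1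
    rw [hA, Finset.sum_range]
    simp

/-- The minors inside a finite `F` sum to `det (1 + V_F U_F) = det (1 + U_F V_F)`. The last matrix
has the fixed size `n`, and Parseval gives its limit as `F` grows. -/
theorem hasSum_principalMinor {ι : Type*} (b : HilbertBasis ι ℝ E) {n : ℕ} (u v : Fin n → E)
    (A : E →L[ℝ] E) (hA : ∀ x, A x = ∑ k, inner ℝ (u k) x • v k) :
    HasSum (principalMinor b A) (Matrix.det (1 + Matrix.of fun k l => inner ℝ (u k) (v l))) := by
  classical
  let V : Matrix ι (Fin n) ℝ := Matrix.of fun i k => inner ℝ (b i) (v k)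
  let U : Matrix (Fin n) ι ℝ := Matrix.of fun k j => inner ℝ (u k) (b j)
  let M : Matrix ι ι ℝ := Matrix.of fun i j => inner ℝ (b i) (A (b j))
  have hM : ∀ i j, M i j = ∑ k, V i k * U k j := by
    intro i j
    simp only [M, V, U, Matrix.of_apply, hA, inner_sum, inner_smul_right]
    exact Finset.sum_congr rfl fun k _ => mul_comm _ _
  have hsub : ∀ S : Finset ι, M.submatrix (Subtype.val : S → ι) Subtype.val =
      V.submatrix (Subtype.val : S → ι) id * U.submatrix id (Subtype.val : S → ι) := by
    intro S
    ext i j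
    simp [Matrix.mul_apply, hM]
  have hpm : ∀ S : Finset ι,
      principalMinor b A S = (M.submatrix (Subtype.val : S → ι) Subtype.val).det := by
    intro S
    rw [principalMinor]
    congr!
  have hsq : ∀ x : E, Summable fun i => (inner ℝ x (b i)) ^ 2 := by
    intro x
    refine (b.summable_inner_mul_inner x x).congr fun i => ?_
    rw [real_inner_comm x, sq]
  -- A summable majorant: the coordinates of each `u k` and `v k` are square summable.
  let γ : ι → ℝ := fun i => (∑ k, |V i k|) * ∑ k, |U k i|
  have hγ0 : ∀ i, 0 ≤ γ i := fun i => by positivity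
  have hγ : Summable γ := by
    have h1 : ∀ k l, Summable fun i => |V i k| * |U l i| := by
      intro k l
      refine Summable.of_nonneg_of_le (fun i => by positivity) (fun i => ?_)
        ((hsq (v k)).add (hsq (u l)))
      have := two_mul_le_add_sq |V i k| |U l i|
      simp only [sq_abs] at this
      have h3 : V i k = inner ℝ (v k) (b i) := real_inner_comm _ _
      have h4 : U l i = inner ℝ (u l) (b i) := rfl
      rw [← h3, ← h4]
      nlinarith [abs_nonneg (V i k), abs_nonneg (U l i)]
    have h2 : γ = fun i => ∑ k, ∑ l, |V i k| * |U l i| := by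
      funext i
      exact Finset.sum_mul_sum _ _ _ _
    rw [h2]
    exact summable_sum fun k _ => summable_sum fun l _ => h1 k l
  -- Minors of size above `n` vanish because they factor through dimension `n`; hence the factorial
  -- from the Leibniz bound never exceeds `n!`.
  have hbound : ∀ S : Finset ι, ‖principalMinor b A S‖ ≤ n.factorial * ∏ i ∈ S, γ i := by
    intro S
    rw [hpm, Real.norm_eq_abs]
    have hp : 0 ≤ ∏ i ∈ S, γ i := Finset.prod_nonneg fun i _ => hγ0 i
    by_cases hS : n < S.card
    · rw [hsub, det_mul_eq_zero_of_card_lt _ _ (by simpa using hS), abs_zero]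
      positivity
    · refine (abs_det_le_of_abs_le_mul _ (fun i : S => ∑ k, |V i k|)
        (fun i : S => ∑ k, |U k i|) fun i j => ?_).trans ?_
      · rw [Matrix.submatrix_apply, hM]
        refine (Finset.abs_sum_le_sum_abs _ _).trans ?_
        rw [Finset.sum_mul]
        refine Finset.sum_le_sum fun k _ => ?_
        rw [abs_mul]
        exact mul_le_mul_of_nonneg_left
          (Finset.single_le_sum (f := fun k => |U k j|) (fun _ _ => abs_nonneg _)
            (Finset.mem_univ k)) (abs_nonneg _)
      · have : ∏ i : S, ((∑ k, |V i k|) * ∑ k, |U k i|) = ∏ i ∈ S, γ i :=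
          Finset.prod_coe_sort S γ
        rw [this]
        refine mul_le_mul_of_nonneg_right ?_ hp
        rw [Fintype.card_coe]
        exact_mod_cast Nat.factorial_le (not_lt.1 hS)
  have hsum : Summable (principalMinor b A) :=
    Summable.of_norm_bounded
      ((summable_finsetProd_of_summable_nonneg hγ0 hγ).mul_left _) hbound
  have hlim1 : Filter.Tendsto (fun F : Finset ι => ∑ S ∈ F.powerset, principalMinor b A S)
      Filter.atTop (nhds (∑' S, principalMinor b A S)) :=
    hsum.hasSum.comp Filter.tendsto_finset_powerset_atTop_atTop
  have hlim2 : Filter.Tendsto (fun F : Finset ι => ∑ S ∈ F.powerset, principalMinor b A S)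
      Filter.atTop (nhds (Matrix.det (1 + Matrix.of fun k l => inner ℝ (u k) (v l)))) := by
    have heq : ∀ F : Finset ι, ∑ S ∈ F.powerset, principalMinor b A S =
        Matrix.det (1 + Matrix.of fun k l => ∑ i ∈ F, inner ℝ (u k) (b i) * inner ℝ (b i) (v l)) := by
      intro F
      simp only [hpm]
      rw [sum_powerset_det_principal_submatrix, hsub, Matrix.det_one_add_mul_comm]
      congr 2
      ext k l
      simp only [Matrix.mul_apply, Matrix.submatrix_apply, Matrix.of_apply, U, V, id]
      exact Finset.sum_coe_sort F fun i => inner ℝ (u k) (b i) * inner ℝ (b i) (v l)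
    simp only [heq]
    have hdet : Continuous fun M : Matrix (Fin n) (Fin n) ℝ => (1 + M).det := by fun_prop
    refine (hdet.tendsto _).comp ?_
    refine tendsto_pi_nhds.2 fun k => tendsto_pi_nhds.2 fun l => ?_
    exact b.hasSum_inner_mul_inner (u k) (v l)
  exact tendsto_nhds_unique hlim1 hlim2 ▸ hsum.hasSum

end FiniteRank

theorem hasFredholmDet_of_finite_rank {E : Type*} [NormedAddCommGroup E] [InnerProductSpace ℝ E]
    {n : ℕ} (u v : Fin n → E) (B : E →L[ℝ] E)
    (hB : ∀ x, B x = x + ∑ k, inner ℝ (u k) x • v k) :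
    HasFredholmDet B (Matrix.det (1 + Matrix.of fun k l => inner ℝ (u k) (v l))) := by
  have hA : ∀ x, (B - 1) x = ∑ k, inner ℝ (u k) x • v k := fun x => by simp [hB]
  exact ⟨isTraceClass_sum_inner_smul u v _ hA, fun ι b => hasSum_principalMinor b u v _ hA⟩

/-! ### Moments of the Gaussian weight -/

theorem integrable_gaussian_mul_eval (P : ℝ[X]) :
    Integrable (fun x : ℝ => Real.exp (-(x ^ 2)) * P.eval x) := by
  induction P using Polynomial.induction_on' with
  | add p q hp hq =>
    refine (hp.add hq).congr (Filter.Eventually.of_forall fun x => ?_)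
    simp [mul_add]
  | monomial k c =>
    have h := integrable_rpow_mul_exp_neg_mul_sq (b := 1) one_pos (s := (k : ℝ))
      (by have : (0 : ℝ) ≤ k := k.cast_nonneg
          linarith)
    refine (h.const_mul c).congr (Filter.Eventually.of_forall fun x => ?_)
    simp [Real.rpow_natCast]
    ring

/-- The functional `P ↦ ∫_s P(x) e^{-x²} dx` on polynomials. -/
def gaussMomentOn (s : Set ℝ) : ℝ[X] →ₗ[ℝ] ℝ where
  toFun P := ∫ x in s, Real.exp (-(x ^ 2)) * P.eval x
  map_add' P Q := by
    rw [← integral_add (integrable_gaussian_mul_eval P).integrableOn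
      (integrable_gaussian_mul_eval Q).integrableOn]
    simp [mul_add]
  map_smul' c P := by
    rw [RingHom.id_apply, smul_eq_mul, ← integral_const_mul]
    simp [mul_left_comm]

/-- The functional `P ↦ ∫_ℝ P(x) e^{-x²} dx` on polynomials. -/
def gaussMoment : ℝ[X] →ₗ[ℝ] ℝ := gaussMomentOn univ

/-- The functional `P ↦ ∫_ℝ sgn(r - x) P(x) e^{-x²} dx` on polynomials. -/
def signedGaussMoment (r : ℝ) : ℝ[X] →ₗ[ℝ] ℝ := gaussMoment - (2 : ℝ) • gaussMomentOn (Ioi r)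

theorem gaussMomentOn_apply (s : Set ℝ) (P : ℝ[X]) :
    gaussMomentOn s P = ∫ x in s, Real.exp (-(x ^ 2)) * P.eval x := rfl

theorem gaussMoment_apply (P : ℝ[X]) :
    gaussMoment P = ∫ x, Real.exp (-(x ^ 2)) * P.eval x := by
  simp [gaussMoment, gaussMomentOn_apply]

theorem signedGaussMoment_apply (r : ℝ) (P : ℝ[X]) :
    signedGaussMoment r P = gaussMoment P - 2 * gaussMomentOn (Ioi r) P := rfl

theorem hasDerivAt_gaussMomentOn_Ioi (P : ℝ[X]) (r : ℝ) :
    HasDerivAt (fun r => gaussMomentOn (Ioi r) P) (-(Real.exp (-(r ^ 2)) * P.eval r)) r := by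
  have hint := integrable_gaussian_mul_eval P
  have hcont : Continuous fun x : ℝ => Real.exp (-(x ^ 2)) * P.eval x := by fun_prop
  have heq : (fun r => gaussMomentOn (Ioi r) P) = fun r => gaussMomentOn (Ioi 0) P -
      ∫ x in (0 : ℝ)..r, Real.exp (-(x ^ 2)) * P.eval x := by
    funext s
    rw [gaussMomentOn_apply, gaussMomentOn_apply,
      ← intervalIntegral.integral_Ioi_sub_Ioi' hint.integrableOn hint.integrableOn]
    ring
  rw [heq]
  exact (intervalIntegral.integral_hasDerivAt_right hint.intervalIntegrable
    hcont.stronglyMeasurable.stronglyMeasurableAtFilter hcont.continuousAt).const_sub _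

theorem hasDerivAt_signedGaussMoment (P : ℝ[X]) (r : ℝ) :
    HasDerivAt (fun r => signedGaussMoment r P) (2 * (Real.exp (-(r ^ 2)) * P.eval r)) r := by
  have h := ((hasDerivAt_gaussMomentOn_Ioi P r).const_mul 2).const_sub (gaussMoment P)
  simp only [mul_neg, neg_neg] at h
  exact h

theorem hasDerivAt_gaussian_mul_eval (P : ℝ[X]) (x : ℝ) :
    HasDerivAt (fun x : ℝ => Real.exp (-(x ^ 2)) * P.eval x)
      (Real.exp (-(x ^ 2)) * (derivative P - 2 * X * P).eval x) x := by
  have h1 : HasDerivAt (fun x : ℝ => Real.exp (-(x ^ 2)))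
      (Real.exp (-(x ^ 2)) * (-(2 * x))) x := by
    have := ((hasDerivAt_pow 2 x).neg).exp
    simpa using this
  refine (h1.fun_mul (P.hasDerivAt x)).congr_deriv ?_
  simp
  ring

theorem gaussMoment_two_X_mul_sub_derivative (P : ℝ[X]) :
    gaussMoment (2 * X * P - derivative P) = 0 := by
  have h := integral_eq_zero_of_hasDerivAt_of_integrable (hasDerivAt_gaussian_mul_eval P)
    (integrable_gaussian_mul_eval _) (integrable_gaussian_mul_eval P)
  rw [← neg_sub, map_neg, gaussMoment_apply, h, neg_zero]

theorem gaussMomentOn_Ioi_two_X_mul_sub_derivative (r : ℝ) (P : ℝ[X]) :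
    gaussMomentOn (Ioi r) (2 * X * P - derivative P) = Real.exp (-(r ^ 2)) * P.eval r := by
  have ht := tendsto_zero_of_hasDerivAt_of_integrableOn_Ioi (a := r)
    (fun x _ => hasDerivAt_gaussian_mul_eval P x)
    (integrable_gaussian_mul_eval _).integrableOn (integrable_gaussian_mul_eval P).integrableOn
  have h := integral_Ioi_of_hasDerivAt_of_tendsto' (a := r)
    (fun x _ => hasDerivAt_gaussian_mul_eval P x)
    (integrable_gaussian_mul_eval _).integrableOn ht
  rw [← neg_sub, map_neg, gaussMomentOn_apply, h]
  ring

theorem signedGaussMoment_two_X_mul_sub_derivative (r : ℝ) (P : ℝ[X]) :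
    signedGaussMoment r (2 * X * P - derivative P) = -(2 * (Real.exp (-(r ^ 2)) * P.eval r)) := by
  rw [signedGaussMoment_apply, gaussMoment_two_X_mul_sub_derivative,
    gaussMomentOn_Ioi_two_X_mul_sub_derivative]
  ring

/-! ### Parity -/

theorem gaussMoment_comp_neg_X (P : ℝ[X]) : gaussMoment (P.comp (-X)) = gaussMoment P := by
  rw [gaussMoment_apply, gaussMoment_apply,
    ← integral_neg_eq_self fun x => Real.exp (-(x ^ 2)) * P.eval x]
  simp

theorem gaussMoment_eq_zero_of_odd {P : ℝ[X]} (hP : P.comp (-X) = -P) : gaussMoment P = 0 := by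
  have h := gaussMoment_comp_neg_X P
  rw [hP, map_neg] at h
  linarith

/-- An even integrand has half of its integral on the positive half-line. -/
theorem signedGaussMoment_zero_of_even {P : ℝ[X]} (hP : P.comp (-X) = P) :
    signedGaussMoment 0 P = 0 := by
  have hev : ∀ x, P.eval |x| = P.eval x := by
    intro x
    rcases abs_choice x with h | h <;> rw [h]
    conv_rhs => rw [← hP]
    simp
  have h := integral_comp_abs (f := fun x => Real.exp (-(x ^ 2)) * P.eval x)
  simp only [sq_abs, hev] at h
  rw [signedGaussMoment_apply, gaussMoment_apply, gaussMomentOn_apply, h, sub_self]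

theorem hermiteH_comp_neg_X (n : ℕ) : (hermiteH n).comp (-X) = (-1) ^ n * hermiteH n := by
  induction n with
  | zero => simp [hermiteH]
  | succ n ih =>
    have h : (derivative (hermiteH n)).comp (-X) = -((-1) ^ n * derivative (hermiteH n)) := by
      have h1 := congrArg derivative ih
      rw [derivative_comp] at h1
      have h2 : derivative ((-1 : ℝ[X]) ^ n * hermiteH n) =
          (-1) ^ n * derivative (hermiteH n) := by
        rcases neg_one_pow_eq_or ℝ[X] n with h | h <;> rw [h] <;> simp
      rw [h2] at h1
      rw [← h1]
      simp
    simp only [hermiteH, sub_comp, mul_comp, h, ih, X_comp, ofNat_comp]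
    ring

theorem derivative_hermiteH_succ (n : ℕ) :
    derivative (hermiteH (n + 1)) = C (2 * (n + 1 : ℝ)) * hermiteH n := by
  induction n with
  | zero =>
    simp only [hermiteH, mul_one, derivative_one, sub_zero, derivative_mul, derivative_ofNat,
      zero_mul, derivative_X, zero_add, CharP.cast_eq_zero]
    rfl
  | succ n ih =>
    rw [hermiteH, derivative_sub, derivative_mul, ih, derivative_mul]
    simp only [hermiteH, derivative_mul, derivative_X, derivative_ofNat, map_mul, derivative_one,
      derivative_natCast, map_add, map_one, map_natCast, map_ofNat, Nat.cast_add, Nat.cast_one,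
      zero_mul, mul_one, zero_add, add_zero]
    ring

/-! ### Families of functionals with integration by parts -/

/-- A family `F r` of functionals on polynomials that behaves like `P ↦ ε ∫ sgn(r - x) P(x) e^{-x²} dx`
under differentiation in `r` and under integration by parts. -/
structure IsGaussFamily (ε : ℝ) (F : ℝ → ℝ[X] →ₗ[ℝ] ℝ) : Prop where
  hasDerivAt : ∀ P r, HasDerivAt (fun r => F r P) (2 * ε * (Real.exp (-(r ^ 2)) * P.eval r)) r
  parts : ∀ P r, F r (2 * X * P - derivative P) = -(2 * ε * (Real.exp (-(r ^ 2)) * P.eval r))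

theorem isGaussFamily_gaussMoment : IsGaussFamily 0 fun _ => gaussMoment where
  hasDerivAt P r := by simpa using hasDerivAt_const r (gaussMoment P)
  parts P r := by simpa using gaussMoment_two_X_mul_sub_derivative P

theorem isGaussFamily_signedGaussMoment : IsGaussFamily 1 signedGaussMoment where
  hasDerivAt P r := by simpa using hasDerivAt_signedGaussMoment P r
  parts P r := by simpa using signedGaussMoment_two_X_mul_sub_derivative r P

namespace IsGaussFamily

variable {ε : ℝ} {F : ℝ → ℝ[X] →ₗ[ℝ] ℝ}

/-- Integration by parts based on `w H_{n+1} = -(w H_n)'`. -/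
theorem hermiteH_succ_mul (hF : IsGaussFamily ε F) (n : ℕ) (q : ℝ[X]) (r : ℝ) :
    F r (hermiteH (n + 1) * q) = F r (hermiteH n * derivative q) -
      2 * ε * (Real.exp (-(r ^ 2)) * (hermiteH n * q).eval r) := by
  have h := hF.parts (hermiteH n * q) r
  have h2 : hermiteH (n + 1) * q =
      (2 * X * (hermiteH n * q) - derivative (hermiteH n * q)) + hermiteH n * derivative q := by
    rw [derivative_mul, hermiteH]
    ring
  rw [h2, map_add, h]
  ring

theorem apply_mul_X_sub_C (P : ℝ[X]) (r : ℝ) : F r (P * (X - C r)) = F r (X * P) - r * F r P := by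
  rw [mul_sub, map_sub, mul_comm P X, mul_comm P (C r), ← smul_eq_C_mul, map_smul, smul_eq_mul]

/-- Moving the jump contributes nothing, as `(x - r)^{l+1}` vanishes there; only the polynomial is
differentiated. The induction peels off one factor `X - r`, so `P` must stay general. -/
theorem hasDerivAt_mul_X_sub_C_pow (hF : IsGaussFamily ε F) (l : ℕ) (P : ℝ[X]) (r : ℝ) :
    HasDerivAt (fun r => F r (P * (X - C r) ^ (l + 1))) (-((l + 1 : ℕ) * F r (P * (X - C r) ^ l)))
      r := by
  induction l generalizing P with
  | zero =>
    simp only [zero_add, pow_one, pow_zero, mul_one, apply_mul_X_sub_C]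
    refine ((hF.hasDerivAt (X * P) r).fun_sub
      ((hasDerivAt_id' r).fun_mul (hF.hasDerivAt P r))).congr_deriv ?_
    simp
    ring
  | succ l ih =>
    have h : ∀ r, F r (P * (X - C r) ^ (l + 1 + 1)) =
        F r (X * P * (X - C r) ^ (l + 1)) - r * F r (P * (X - C r) ^ (l + 1)) := by
      intro r
      rw [pow_succ _ (l + 1), ← mul_assoc, apply_mul_X_sub_C, mul_assoc]
    have h' : F r (P * (X - C r) ^ (l + 1)) =
        F r (X * P * (X - C r) ^ l) - r * F r (P * (X - C r) ^ l) := by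
      rw [pow_succ, ← mul_assoc, apply_mul_X_sub_C, mul_assoc]
    simp only [h]
    refine ((ih (X * P)).fun_sub ((hasDerivAt_id' r).fun_mul (ih P))).congr_deriv ?_
    rw [h']
    push_cast
    ring

/-- Differentiating in `r` produces exactly the terms of one integration by parts, so it raises the
Hermite index. -/
theorem hasDerivAt_hermiteH_mul_X_sub_C_pow (hF : IsGaussFamily ε F) (n l : ℕ) (r : ℝ) :
    HasDerivAt (fun r => F r (hermiteH n * (X - C r) ^ l))
      (-F r (hermiteH (n + 1) * (X - C r) ^ l)) r := by
  rw [hF.hermiteH_succ_mul]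
  cases l with
  | zero =>
    simpa using hF.hasDerivAt (hermiteH n) r
  | succ l =>
    refine (hF.hasDerivAt_mul_X_sub_C_pow l (hermiteH n) r).congr_deriv ?_
    have h : derivative ((X - C r) ^ (l + 1)) = (l + 1 : ℝ) • (X - C r) ^ l := by
      rw [derivative_X_sub_C_pow, smul_eq_C_mul]
      simp
    rw [h, mul_smul_comm, map_smul]
    simp

/-- Each integration by parts lowers the power of `X - r`. The boundary terms vanish as long as that
power is positive, so only the last one remains. -/
theorem hermiteH_mul_X_sub_C_pow_of_lt (hF : IsGaussFamily ε F) (r : ℝ) {n l : ℕ} (h : l ≤ n) :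
    F r (hermiteH (n + 1) * (X - C r) ^ l) =
      -(2 * ε * (Real.exp (-(r ^ 2)) * (l.factorial * (hermiteH (n - l)).eval r))) := by
  induction l generalizing n with
  | zero => rw [hF.hermiteH_succ_mul]; simp
  | succ l ih =>
    obtain ⟨n, rfl⟩ : ∃ k, n = k + 1 := ⟨n - 1, by omega⟩
    have hd : derivative ((X - C r) ^ (l + 1)) = (l + 1 : ℝ) • (X - C r) ^ l := by
      rw [derivative_X_sub_C_pow, smul_eq_C_mul]
      simp
    rw [hF.hermiteH_succ_mul, hd, mul_smul_comm, map_smul, ih (by omega), Nat.factorial_succ]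
    simp
    ring

end IsGaussFamily

/-! ### Translated Hermite polynomials -/

/-- The truncation `∑_{j < M} rʲ / j! · H_{n + j}` of the Hermite expansion of
`e^{2xr - r²} H_n(x - r)`. -/
def truncTranslate (n M : ℕ) (r : ℝ) : ℝ[X] :=
  ∑ j ∈ Finset.range M, (r ^ j / j.factorial) • hermiteH (n + j)

/-- The sum telescopes: the derivative of `rʲ / j!` cancels the raised index of the preceding term,
leaving only the top one. -/
theorem IsGaussFamily.hasDerivAt_truncTranslate_mul {ε : ℝ} {F : ℝ → ℝ[X] →ₗ[ℝ] ℝ}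
    (hF : IsGaussFamily ε F) (n M l : ℕ) (r : ℝ) :
    HasDerivAt (fun r => F r (truncTranslate n (M + 1) r * (X - C r) ^ l))
      (-(r ^ M / M.factorial * F r (hermiteH (n + M + 1) * (X - C r) ^ l))) r := by
  have hexp : ∀ M r, F r (truncTranslate n M r * (X - C r) ^ l) = ∑ j ∈ Finset.range M,
      r ^ j / j.factorial * F r (hermiteH (n + j) * (X - C r) ^ l) := by
    intro M r
    simp [truncTranslate, Finset.sum_mul]
  simp only [hexp]
  induction M with
  | zero =>
    simpa using hF.hasDerivAt_hermiteH_mul_X_sub_C_pow n l r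
  | succ M ih =>
    simp only [Finset.sum_range_succ _ (M + 1)]
    refine (ih.fun_add (((hasDerivAt_pow (M + 1) r).div_const ((M + 1).factorial : ℝ)).fun_mul
      (hF.hasDerivAt_hermiteH_mul_X_sub_C_pow (n + (M + 1)) l r))).congr_deriv ?_
    have h1 : ((M + 1 : ℕ) : ℝ) * r ^ (M + 1 - 1) / (M + 1).factorial = r ^ M / M.factorial := by
      rw [Nat.factorial_succ, Nat.cast_mul]
      simp only [Nat.add_sub_cancel]
      rw [mul_div_mul_left]
      positivity
    rw [h1]
    ring_nf

/-- The difference of the two sides does not depend on `r`. -/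
theorem IsGaussFamily.truncTranslate_mul_eq {ε : ℝ} {F : ℝ → ℝ[X] →ₗ[ℝ] ℝ}
    (hF : IsGaussFamily ε F) (n M l : ℕ) (hl : l ≤ n + M)
    (h0 : F 0 (hermiteH n * X ^ l) =
      F 0 (((l.factorial : ℝ) / M.factorial) • (X ^ M * hermiteH (n + M - l)))) (r : ℝ) :
    F r (truncTranslate n (M + 1) r * (X - C r) ^ l) =
      F r (((l.factorial : ℝ) / M.factorial) • (X ^ M * hermiteH (n + M - l))) := by
  have hd : ∀ r, HasDerivAt (fun r => F r (truncTranslate n (M + 1) r * (X - C r) ^ l) -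
      F r (((l.factorial : ℝ) / M.factorial) • (X ^ M * hermiteH (n + M - l)))) 0 r := by
    intro r
    refine ((hF.hasDerivAt_truncTranslate_mul n M l r).fun_sub
      (hF.hasDerivAt _ r)).congr_deriv ?_
    -- The surviving top term is a pure boundary term, equal to the derivative of the right-hand
    -- side.
    rw [hF.hermiteH_mul_X_sub_C_pow_of_lt r hl]
    simp
    ring
  have hc := is_const_of_deriv_eq_zero (fun r => (hd r).differentiableAt)
    (fun r => (hd r).deriv) r 0
  have hz : truncTranslate n (M + 1) 0 = hermiteH n := by
    rw [truncTranslate, Finset.sum_range_succ']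
    simp
  simp only [hz, map_zero, sub_zero, h0, sub_self] at hc
  linarith

/-! ### Initial values at `r = 0`, and the resulting pairings -/

theorem gaussMoment_hermiteH_mul (n : ℕ) (q : ℝ[X]) :
    gaussMoment (hermiteH n * q) = gaussMoment (derivative^[n] q) := by
  induction n generalizing q with
  | zero => simp [hermiteH]
  | succ n ih =>
    have h := isGaussFamily_gaussMoment.hermiteH_succ_mul n q 0
    rw [mul_zero, zero_mul, sub_zero] at h
    rw [h, ih, Function.iterate_succ_apply]

theorem gaussMoment_hermiteH_mul_X_pow (n l : ℕ) :
    gaussMoment (hermiteH n * X ^ l) = l.descFactorial n * gaussMoment (X ^ (l - n)) := by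
  rw [gaussMoment_hermiteH_mul, iterate_derivative_X_pow_eq_smul, map_smul, smul_eq_mul]

/-- Both sides equal `l! / (l - n)!` times the moment of `X^{l-n}`, or vanish when `l < n`. -/
theorem gaussMoment_hermiteH_mul_X_pow_eq (n M l : ℕ) (hl : l ≤ n + M) :
    gaussMoment (hermiteH n * X ^ l) =
      gaussMoment (((l.factorial : ℝ) / M.factorial) • (X ^ M * hermiteH (n + M - l))) := by
  rw [map_smul, mul_comm (X ^ M), gaussMoment_hermiteH_mul_X_pow, gaussMoment_hermiteH_mul_X_pow]
  by_cases h : l < n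
  · rw [Nat.descFactorial_of_lt h, Nat.descFactorial_of_lt (by omega)]
    simp
  · have h1 : M - (n + M - l) = l - n := by omega
    have h2 := Nat.factorial_mul_descFactorial (not_lt.1 h)
    have h3 := Nat.factorial_mul_descFactorial (show n + M - l ≤ M by omega)
    rw [h1] at h3 ⊢
    rw [← h2, ← h3]
    have := (l - n).factorial_ne_zero
    have := (Nat.descFactorial_pos.2 (show n + M - l ≤ M by omega)).ne'
    push_cast
    rw [smul_eq_mul]
    field_simp

theorem gaussMoment_truncTranslate_mul (n M l : ℕ) (hl : l ≤ n + M) (r : ℝ) :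
    gaussMoment (truncTranslate n (M + 1) r * (X - C r) ^ l) =
      gaussMoment (((l.factorial : ℝ) / M.factorial) • (X ^ M * hermiteH (n + M - l))) :=
  isGaussFamily_gaussMoment.truncTranslate_mul_eq n M l hl
    (gaussMoment_hermiteH_mul_X_pow_eq n M l hl) r

theorem hermiteH_mul_X_pow_comp_neg_X (n l : ℕ) :
    (hermiteH n * X ^ l).comp (-X) = (-1) ^ (n + l) * (hermiteH n * X ^ l) := by
  rw [mul_comp, hermiteH_comp_neg_X, X_pow_comp, neg_pow]
  ring

/-- Even parity of `n + l` makes both polynomials even at `r = 0`, where the signed moment kills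
them. -/
theorem signedGaussMoment_truncTranslate_mul (n M l : ℕ) (hl : l ≤ n + M) (hpar : Even (n + l))
    (r : ℝ) :
    signedGaussMoment r (truncTranslate n (M + 1) r * (X - C r) ^ l) =
      signedGaussMoment r
        (((l.factorial : ℝ) / M.factorial) • (X ^ M * hermiteH (n + M - l))) := by
  refine isGaussFamily_signedGaussMoment.truncTranslate_mul_eq n M l hl ?_ r
  rw [map_smul, signedGaussMoment_zero_of_even, signedGaussMoment_zero_of_even, smul_zero]
  · rw [mul_comm, hermiteH_mul_X_pow_comp_neg_X, Even.neg_one_pow, one_mul]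
    obtain ⟨k, hk⟩ := hpar
    exact ⟨n + M - k, by omega⟩
  · rw [hermiteH_mul_X_pow_comp_neg_X, Even.neg_one_pow hpar, one_mul]

/-! ### Orthonormality of the Hermite polynomials -/

theorem gaussMoment_one : gaussMoment 1 = Real.sqrt Real.pi := by
  have h := integral_gaussian 1
  rw [gaussMoment_apply]
  simpa using h

theorem gaussMoment_hermiteH_mul_hermiteH (n m : ℕ) :
    gaussMoment (hermiteH n * hermiteH m) =
      if n = m then Real.sqrt Real.pi * 2 ^ n * n.factorial else 0 := by
  have hparts : ∀ n q, gaussMoment (hermiteH (n + 1) * q) =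
      gaussMoment (hermiteH n * derivative q) := by
    intro n q
    simpa using isGaussFamily_gaussMoment.hermiteH_succ_mul n q 0
  induction n generalizing m with
  | zero =>
    cases m with
    | zero => simp [hermiteH, gaussMoment_one]
    | succ m =>
      rw [mul_comm, hparts]
      simp [hermiteH]
  | succ n ih =>
    cases m with
    | zero =>
      rw [hparts]
      simp [hermiteH]
    | succ m =>
      rw [hparts, derivative_hermiteH_succ, mul_left_comm, ← smul_eq_C_mul, map_smul, ih,
        smul_eq_mul]
      by_cases h : n = m
      · subst h
        simp [Nat.factorial_succ]
        ring
      · simp [h]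

/-- The Hermite polynomials, orthonormal with respect to the weight `e^{-x²}`. -/
def normedHermite (n : ℕ) : ℝ[X] :=
  (Real.sqrt (Real.sqrt Real.pi * 2 ^ n * n.factorial))⁻¹ • hermiteH n

theorem gaussMoment_normedHermite_mul (n m : ℕ) :
    gaussMoment (normedHermite n * normedHermite m) = if n = m then 1 else 0 := by
  rw [normedHermite, normedHermite, smul_mul_smul_comm, map_smul,
    gaussMoment_hermiteH_mul_hermiteH, smul_eq_mul]
  by_cases h : n = m
  · subst h
    have h0 : 0 < Real.sqrt Real.pi * 2 ^ n * n.factorial := by positivity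
    simp only [if_true]
    rw [← mul_inv, Real.mul_self_sqrt h0.le, inv_mul_cancel₀ h0.ne']
  · simp [h]

theorem hermiteH_eq_smul_normedHermite (n : ℕ) :
    hermiteH n = Real.sqrt (Real.sqrt Real.pi * 2 ^ n * n.factorial) • normedHermite n := by
  have h0 : 0 < Real.sqrt Real.pi * 2 ^ n * n.factorial := by positivity
  rw [normedHermite, smul_inv_smul₀ (Real.sqrt_pos.2 h0).ne']

theorem hermiteFun_eq (n : ℕ) (x : ℝ) :
    hermiteFun n x = Real.exp (-(x ^ 2) / 2) * (normedHermite n).eval x := by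
  simp only [hermiteFun, normedHermite, eval_smul, smul_eq_mul]
  ring

theorem exp_neg_sq_half_mul_self (x : ℝ) :
    Real.exp (-(x ^ 2) / 2) * Real.exp (-(x ^ 2) / 2) = Real.exp (-(x ^ 2)) := by
  rw [← Real.exp_add]
  ring_nf

/-! ### Spans of Hermite polynomials -/

theorem X_mul_hermiteH_succ (n : ℕ) :
    X * hermiteH (n + 1) = (1 / 2 : ℝ) • hermiteH (n + 2) + (n + 1 : ℝ) • hermiteH n := by
  have h2 : hermiteH (n + 2) = (2 : ℝ) • (X * hermiteH (n + 1)) - (2 * (n + 1 : ℝ)) • hermiteH n := by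
    rw [smul_eq_C_mul (2 * (n + 1 : ℝ)), ← derivative_hermiteH_succ, two_smul, hermiteH]
    ring
  rw [h2]
  module

/-- The three-term recurrence changes the index by one in either direction, so parity is preserved
along the induction. -/
theorem X_pow_mem_span_hermiteH (n : ℕ) :
    (X ^ n : ℝ[X]) ∈ Submodule.span ℝ (hermiteH '' {j | j ≤ n ∧ Even (n + j)}) := by
  induction n with
  | zero => exact Submodule.subset_span ⟨0, by simp, by simp [hermiteH]⟩
  | succ n ih =>
    rw [pow_succ']
    refine Submodule.span_induction (p := fun P _ => X * P ∈ _) ?_ (by simp) ?_ ?_ ih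
    · rintro _ ⟨j, ⟨hj, hpar⟩, rfl⟩
      cases j with
      | zero =>
        have : X * hermiteH 0 = (1 / 2 : ℝ) • hermiteH 1 := by
          have h : hermiteH 1 = (2 : ℝ) • (X : ℝ[X]) := by
            rw [two_smul]
            simp [hermiteH, two_mul]
          rw [h]
          simp [hermiteH]
        rw [this]
        exact Submodule.smul_mem _ _ (Submodule.subset_span ⟨1, ⟨by omega, by grind⟩, rfl⟩)
      | succ j =>
        rw [X_mul_hermiteH_succ]
        exact Submodule.add_mem _
          (Submodule.smul_mem _ _ (Submodule.subset_span ⟨j + 2, ⟨by omega, by grind⟩, rfl⟩))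
          (Submodule.smul_mem _ _ (Submodule.subset_span ⟨j, ⟨by omega, by grind⟩, rfl⟩))
    · intro P Q _ _ hP hQ
      rw [mul_add]
      exact Submodule.add_mem _ hP hQ
    · intro c P _ hP
      rw [mul_smul_comm]
      exact Submodule.smul_mem _ _ hP

theorem hermiteH_mem_span_normedHermite {N n : ℕ} (hn : n < N) :
    hermiteH n ∈ Submodule.span ℝ (range fun i : Fin N => normedHermite i) := by
  rw [hermiteH_eq_smul_normedHermite]
  exact Submodule.smul_mem _ _ (Submodule.subset_span ⟨⟨n, hn⟩, rfl⟩)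

theorem mem_span_normedHermite {N : ℕ} {P : ℝ[X]} (hP : P.natDegree < N) :
    P ∈ Submodule.span ℝ (range fun i : Fin N => normedHermite i) := by
  rw [P.as_sum_range' N hP]
  refine Submodule.sum_mem _ fun i hi => ?_
  rw [← smul_X_eq_monomial]
  refine Submodule.smul_mem _ _ (Submodule.span_le.2 ?_ (X_pow_mem_span_hermiteH i))
  rintro _ ⟨j, ⟨hj, -⟩, rfl⟩
  exact hermiteH_mem_span_normedHermite (hj.trans_lt (Finset.mem_range.1 hi))

/-- The orthonormal Hermite polynomials of a fixed parity, with alternating signs. -/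
def parityHermite (ε k : ℕ) : ℝ[X] := (-1 : ℝ) ^ k • normedHermite (2 * k + ε)

theorem gaussMoment_parityHermite_mul (ε j k : ℕ) :
    gaussMoment (parityHermite ε j * parityHermite ε k) = if j = k then 1 else 0 := by
  rw [parityHermite, parityHermite, smul_mul_smul_comm, map_smul, gaussMoment_normedHermite_mul,
    smul_eq_mul]
  by_cases h : j = k
  · subst h
    simp [← mul_pow]
  · simp [h]

theorem hermiteH_mem_span_parityHermite {m ε k : ℕ} (hk : k < m) :
    hermiteH (2 * k + ε) ∈ Submodule.span ℝ (range fun i : Fin m => parityHermite ε i) := by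
  have h : normedHermite (2 * k + ε) = (-1 : ℝ) ^ k • parityHermite ε k := by
    rw [parityHermite, smul_smul, ← mul_pow]
    simp
  rw [hermiteH_eq_smul_normedHermite, h]
  exact Submodule.smul_mem _ _ (Submodule.smul_mem _ _ (Submodule.subset_span ⟨⟨k, hk⟩, rfl⟩))

theorem X_pow_mem_span_parityHermite {m ε k : ℕ} (hε : ε ≤ 1) (hk : k < m) :
    (X ^ (2 * k + ε) : ℝ[X]) ∈ Submodule.span ℝ (range fun i : Fin m => parityHermite ε i) := by
  refine Submodule.span_le.2 ?_ (X_pow_mem_span_hermiteH (2 * k + ε))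
  rintro _ ⟨j, ⟨hj, hpar⟩, rfl⟩
  obtain ⟨i, rfl⟩ : ∃ i, j = 2 * i + ε := ⟨(j - ε) / 2, by grind⟩
  exact hermiteH_mem_span_parityHermite (by omega)

/-! ### Determinants of bilinear forms -/

/-- Expanding `p` and `q` in `e` multiplies both determinants by the same two coordinate
determinants, and `G` is the identity on `e`. The families `p` and `q` may differ. -/
theorem det_bilin_eq_det_mul_det {V ι : Type*} [AddCommGroup V] [Module ℝ V] [Fintype ι]
    [DecidableEq ι] (B G : V →ₗ[ℝ] V →ₗ[ℝ] ℝ) (e p q : ι → V)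
    (he : ∀ i j, G (e i) (e j) = if i = j then 1 else 0)
    (hp : ∀ i, p i ∈ Submodule.span ℝ (range e)) (hq : ∀ i, q i ∈ Submodule.span ℝ (range e)) :
    (Matrix.of fun i j => B (p i) (q j)).det =
      (Matrix.of fun i j => B (e i) (e j)).det * (Matrix.of fun i j => G (p i) (q j)).det := by
  choose α hα using fun i => (Submodule.mem_span_range_iff_exists_fun ℝ).1 (hp i)
  choose β hβ using fun i => (Submodule.mem_span_range_iff_exists_fun ℝ).1 (hq i)
  have key : ∀ T : V →ₗ[ℝ] V →ₗ[ℝ] ℝ, (Matrix.of fun i j => T (p i) (q j)) =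
      Matrix.of α * (Matrix.of fun i j => T (e i) (e j)) * (Matrix.of β).transpose := by
    intro T
    ext i j
    simp only [← hα, ← hβ, Matrix.of_apply, Matrix.mul_apply, Matrix.transpose_apply, map_sum,
      map_smul, LinearMap.sum_apply, LinearMap.smul_apply, smul_eq_mul, Finset.mul_sum,
      Finset.sum_mul]
    refine Finset.sum_congr rfl fun k _ => Finset.sum_congr rfl fun l _ => ?_
    ring
  have h1 : (Matrix.of fun i j => G (e i) (e j)) = 1 := by
    ext i j
    simp [he, Matrix.one_apply]
  rw [key B, key G, h1]
  simp only [Matrix.det_mul, Matrix.det_one]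
  ring

/-- The bilinear form `(P, Q) ↦ Λ (P Q)` attached to a functional `Λ`. -/
def mulForm (Λ : ℝ[X] →ₗ[ℝ] ℝ) : ℝ[X] →ₗ[ℝ] ℝ[X] →ₗ[ℝ] ℝ := (LinearMap.mul ℝ ℝ[X]).compr₂ Λ

theorem mulForm_apply (Λ : ℝ[X] →ₗ[ℝ] ℝ) (P Q : ℝ[X]) : mulForm Λ P Q = Λ (P * Q) := rfl

/-- The form `(P, Q) ↦ ∫_{-∞}^r P Q w - ∫_r^∞ P(x) Q(2r - x) w(x) dx` with `w = e^{-x²}`. -/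
def reflectedForm (r : ℝ) : ℝ[X] →ₗ[ℝ] ℝ[X] →ₗ[ℝ] ℝ :=
  mulForm (gaussMoment - gaussMomentOn (Ioi r)) -
    (mulForm (gaussMomentOn (Ioi r))).compl₂ (aeval (C (2 * r) - X)).toLinearMap

theorem reflectedForm_apply (r : ℝ) (P Q : ℝ[X]) :
    reflectedForm r P Q = gaussMoment (P * Q) - gaussMomentOn (Ioi r) (P * Q) -
      gaussMomentOn (Ioi r) (P * Q.comp (C (2 * r) - X)) := by
  rw [comp_eq_aeval]
  rfl

/-- The reflection acts on `(X - r)^l` by the sign `(-1)^l`: the two tail integrals cancel for odd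
`l` and double for even `l`. -/
theorem reflectedForm_mul_X_sub_C_pow (r : ℝ) (P : ℝ[X]) (l : ℕ) :
    reflectedForm r P ((X - C r) ^ l) = gaussMoment (P * (X - C r) ^ l) -
      (1 + (-1) ^ l) * gaussMomentOn (Ioi r) (P * (X - C r) ^ l) := by
  have h : ((X - C r) ^ l).comp (C (2 * r) - X) = (-1 : ℝ) ^ l • (X - C r) ^ l := by
    rw [pow_comp, sub_comp, X_comp, C_comp]
    have : C (2 * r) - X - C r = -(X - C r : ℝ[X]) := by
      rw [two_mul, C_add]
      ring
    rw [this, neg_pow, smul_eq_C_mul]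
    simp
  rw [reflectedForm_apply, h, mul_smul_comm, map_smul, smul_eq_mul]
  ring

/-- The heart of the proof: in bases adapted to the point `r`, the reflected form is block
triangular with respect to index parity. -/
theorem det_reflectedForm_eq {N m ε : ℕ} (hε : ε ≤ 1) (hN : N + 1 = 2 * m + ε) (r : ℝ) :
    (Matrix.of fun i j : Fin N => reflectedForm r (normedHermite i) (normedHermite j)).det =
      (Matrix.of fun i j : Fin m =>
        signedGaussMoment r (parityHermite ε i * parityHermite ε j)).det := by
  -- The truncation stops at `H_{N-1}`: `p n` stays in the span of the first `N` Hermite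
  -- polynomials, and `n + M = N - 1` for every row.
  let p : Fin N → ℝ[X] := fun n => truncTranslate n (N - 1 - n + 1) r
  let q : Fin N → ℝ[X] := fun l => (X - C r) ^ (l : ℕ)
  have hle : ∀ n l : Fin N, (l : ℕ) ≤ n + (N - 1 - n) := fun n l => by omega
  have hadd : ∀ n : Fin N, (n : ℕ) + (N - 1 - n) = N - 1 := fun n => by omega
  let Γ : Matrix (Fin N) (Fin N) ℝ := Matrix.of fun n l => gaussMoment (p n * q l)
  let β : Matrix (Fin N) (Fin N) ℝ := Matrix.of fun n l => reflectedForm r (p n) (q l)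
  have hΓ : ∀ n l, Γ n l = (l : ℕ).descFactorial n * gaussMoment (X ^ (l - n : ℕ)) := by
    intro n l
    rw [← gaussMoment_hermiteH_mul_X_pow, gaussMoment_hermiteH_mul_X_pow_eq _ _ _ (hle n l),
      ← gaussMoment_truncTranslate_mul _ _ _ (hle n l) r]
    rfl
  have hΓpar : ∀ n l : Fin N, ¬ Even ((n : ℕ) + l) → Γ n l = 0 := by
    intro n l h
    rw [hΓ, ← gaussMoment_hermiteH_mul_X_pow]
    refine gaussMoment_eq_zero_of_odd ?_
    rw [hermiteH_mul_X_pow_comp_neg_X, (Nat.not_even_iff_odd.1 h).neg_one_pow, neg_one_mul]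
  have hβodd : ∀ n l : Fin N, ¬ Even (l : ℕ) → β n l = Γ n l := by
    intro n l h
    have := reflectedForm_mul_X_sub_C_pow r (p n) l
    rw [(Nat.not_even_iff_odd.1 h).neg_one_pow, add_neg_cancel, zero_mul, sub_zero] at this
    exact this
  have hβeven : ∀ n l : Fin N, Even (l : ℕ) → β n l = signedGaussMoment r (p n * q l) := by
    intro n l h
    have := reflectedForm_mul_X_sub_C_pow r (p n) l
    rw [h.neg_one_pow, one_add_one_eq_two] at this
    exact this
  have hΓdet : Γ.det ≠ 0 := by
    rw [Matrix.det_of_isUpperTriangular]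
    · refine Finset.prod_ne_zero_iff.2 fun n _ => ?_
      rw [hΓ, Nat.sub_self, pow_zero, gaussMoment_one, Nat.descFactorial_self]
      positivity
    · intro n l h
      rw [hΓ, Nat.descFactorial_of_lt (by exact h)]
      simp
  have hspan : β.det =
      (Matrix.of fun i j : Fin N => reflectedForm r (normedHermite i) (normedHermite j)).det *
        Γ.det := by
    refine det_bilin_eq_det_mul_det (reflectedForm r) (mulForm gaussMoment)
      (fun i : Fin N => normedHermite i) p q (fun i j => ?_) (fun n => ?_) (fun l => ?_)
    · rw [mulForm_apply, gaussMoment_normedHermite_mul]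
      simp [Fin.ext_iff]
    · refine Submodule.sum_mem _ fun j hj => Submodule.smul_mem _ _
        (hermiteH_mem_span_normedHermite ?_)
      have := Finset.mem_range.1 hj
      omega
    · refine mem_span_normedHermite ?_
      rw [natDegree_pow, natDegree_X_sub_C, mul_one]
      exact l.2
  -- In even rows and odd columns the reflected form is a Gauss moment of mixed parity, hence zero.
  have hβblock := Matrix.twoBlockTriangular_det' β (fun i : Fin N => Even (i : ℕ))
    fun i hi j hj => by
      rw [hβodd i j hj, hΓpar i j fun h => hj ((Nat.even_add.1 h).1 hi)]
  have hΓblock := Matrix.twoBlockTriangular_det' Γ (fun i : Fin N => Even (i : ℕ))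
    fun i hi j hj => hΓpar i j fun h => hj ((Nat.even_add.1 h).1 hi)
  have hoo : Matrix.toSquareBlockProp β (fun i : Fin N => ¬ Even (i : ℕ)) =
      Matrix.toSquareBlockProp Γ (fun i : Fin N => ¬ Even (i : ℕ)) := by
    ext i j
    exact hβodd i j j.2
  let f : Fin m → {i : Fin N // Even (i : ℕ)} := fun k => ⟨⟨2 * k, by omega⟩, even_two_mul _⟩
  have hf : Function.Bijective f := by
    refine ⟨fun a b h => ?_, fun i => ?_⟩
    · have : 2 * (a : ℕ) = 2 * b := congrArg (fun i : {i : Fin N // Even (i : ℕ)} => (i.1 : ℕ)) h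
      exact Fin.ext (by omega)
    · obtain ⟨k, hk⟩ := i.2
      have := i.1.2
      refine ⟨⟨k, by omega⟩, Subtype.ext (Fin.ext ?_)⟩
      simp only [f]
      omega
  -- The pairing formula on even indices splits into a row factor and a column factor, because `n +
  -- M` is constant. Both have the parity of `N - 1`.
  let p' : Fin m → ℝ[X] := fun k =>
    (((N - 1 - 2 * k : ℕ).factorial : ℝ)⁻¹) • (X : ℝ[X]) ^ (N - 1 - 2 * k : ℕ)
  let q' : Fin m → ℝ[X] := fun k => ((2 * k : ℕ).factorial : ℝ) • hermiteH (N - 1 - 2 * k)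
  have hpq : ∀ k l : Fin m, p' k * q' l = (((2 * l : ℕ).factorial : ℝ) /
      (N - 1 - 2 * k : ℕ).factorial) • (X ^ (N - 1 - 2 * k : ℕ) *
        hermiteH (2 * k + (N - 1 - 2 * k) - 2 * l)) := by
    intro k l
    simp only [p', q']
    rw [smul_mul_smul_comm, div_eq_inv_mul, show 2 * (k : ℕ) + (N - 1 - 2 * k) = N - 1 by omega]
  have hee : ∀ M : Matrix (Fin N) (Fin N) ℝ,
      (Matrix.toSquareBlockProp M (fun i : Fin N => Even (i : ℕ))).det =
        (Matrix.of fun k l : Fin m => M (f k) (f l)).det := fun M =>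
    (Matrix.det_submatrix_equiv_self (Equiv.ofBijective f hf)
      (Matrix.toSquareBlockProp M (fun i : Fin N => Even (i : ℕ)))).symm
  have hβe : (Matrix.of fun k l : Fin m => β (f k) (f l)) =
      Matrix.of fun k l => mulForm (signedGaussMoment r) (p' k) (q' l) := by
    ext k l
    rw [Matrix.of_apply, Matrix.of_apply, mulForm_apply, hpq, hβeven _ _ (f l).2]
    exact signedGaussMoment_truncTranslate_mul _ _ _ (hle (f k) (f l)) (by simp [f, Nat.even_add]) r
  have hΓe : (Matrix.of fun k l : Fin m => Γ (f k) (f l)) =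
      Matrix.of fun k l => mulForm gaussMoment (p' k) (q' l) := by
    ext k l
    rw [Matrix.of_apply, Matrix.of_apply, mulForm_apply, hpq]
    exact gaussMoment_truncTranslate_mul _ _ _ (hle (f k) (f l)) r
  have hmain := det_bilin_eq_det_mul_det (mulForm (signedGaussMoment r)) (mulForm gaussMoment)
    (fun k : Fin m => parityHermite ε k) p' q'
    (fun i j => by
      rw [mulForm_apply, gaussMoment_parityHermite_mul]
      simp [Fin.ext_iff])
    (fun k => by
      refine Submodule.smul_mem _ _ ?_
      rw [show N - 1 - 2 * (k : ℕ) = 2 * (m - 1 - k) + ε by omega]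
      exact X_pow_mem_span_parityHermite hε (by omega))
    (fun k => by
      refine Submodule.smul_mem _ _ ?_
      rw [show N - 1 - 2 * (k : ℕ) = 2 * (m - 1 - k) + ε by omega]
      exact hermiteH_mem_span_parityHermite (by omega))
  refine mul_right_cancel₀ hΓdet ?_
  rw [← hspan, hβblock, hΓblock, hoo, hee, hee, hβe, hΓe, hmain, mul_assoc]
  rfl

/-! ### Laguerre polynomials of parameter `±1/2` as Hermite polynomials -/

theorem coeff_laguerreL (a : ℝ) (n k : ℕ) :
    (laguerreL a n).coeff k = if k ≤ n then
      (-1) ^ k * ((∏ i ∈ Finset.Ioc k n, (a + i)) / ((n - k).factorial * k.factorial)) else 0 := by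
  have h : ∀ j : ℕ, (-X : ℝ[X]) ^ j = C ((-1) ^ j) * X ^ j := by
    intro j
    rw [neg_pow]
    simp
  simp only [laguerreL, finsetSum_coeff, h, ← mul_assoc, ← C_mul, coeff_C_mul_X_pow,
    Finset.sum_ite_eq, Finset.mem_range, Nat.lt_succ_iff]
  split_ifs <;> ring

theorem prod_Ioc_add_one_add (a : ℝ) (k n : ℕ) :
    ∏ i ∈ Finset.Ioc k n, (a + 1 + i) = ∏ i ∈ Finset.Ioc (k + 1) (n + 1), (a + i) := by
  rw [← Finset.map_add_right_Ioc k n 1, Finset.prod_map]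
  refine Finset.prod_congr rfl fun i _ => ?_
  rw [addRightEmbedding_apply]
  push_cast
  ring

theorem prod_Ioc_add_eq_mul (a : ℝ) {k n : ℕ} (h : k < n) :
    ∏ i ∈ Finset.Ioc k n, (a + i) = (a + (k + 1 : ℕ)) * ∏ i ∈ Finset.Ioc (k + 1) n, (a + i) := by
  rw [← Finset.prod_Ioc_consecutive _ (Nat.le_succ k) h]
  simp

theorem laguerreL_add_one (a : ℝ) (n : ℕ) :
    laguerreL (a + 1) n = laguerreL a n - derivative (laguerreL a n) := by
  ext k
  rw [coeff_sub, coeff_derivative]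
  simp only [coeff_laguerreL]
  rcases lt_trichotomy k n with h | rfl | h
  · obtain ⟨d, rfl⟩ : ∃ d, n = k + d + 1 := ⟨n - k - 1, by omega⟩
    rw [if_pos h.le, if_pos (by omega), prod_Ioc_add_one_add, if_pos (by omega),
      prod_Ioc_add_eq_mul a h, Finset.prod_Ioc_succ_top (by omega), show k + d + 1 - k = d + 1 by omega,
      show k + d + 1 - (k + 1) = d by omega, Nat.factorial_succ, Nat.factorial_succ]
    push_cast
    field_simp
    ring
  · simp
  · rw [if_neg (by omega), if_neg (by omega), if_neg (by omega)]
    simp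

theorem laguerreL_succ (a : ℝ) (n : ℕ) :
    (n + 1 : ℝ) • laguerreL a (n + 1) = (a + 1) • laguerreL (a + 1) n - X * laguerreL (a + 1) n +
      X * derivative (laguerreL (a + 1) n) := by
  ext k
  cases k with
  | zero =>
    simp only [coeff_add, coeff_sub, coeff_smul, coeff_X_mul_zero, coeff_laguerreL, smul_eq_mul,
      prod_Ioc_add_one_add, prod_Ioc_add_eq_mul a (Nat.succ_pos n), zero_le, if_true, Nat.sub_zero,
      Nat.factorial_succ, Nat.factorial_zero]
    push_cast
    field_simp
    ring
  | succ k =>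
    simp only [coeff_add, coeff_sub, coeff_smul, coeff_X_mul, coeff_derivative, coeff_laguerreL,
      smul_eq_mul, prod_Ioc_add_one_add]
    rcases lt_trichotomy k n with h | rfl | h
    · obtain ⟨d, rfl⟩ : ∃ d, n = k + d + 1 := ⟨n - k - 1, by omega⟩
      rw [if_pos (by omega), if_pos h.le, if_pos (by omega),
        prod_Ioc_add_eq_mul a (show k + 1 < k + d + 1 + 1 by omega),
        show k + d + 1 + 1 - (k + 1) = d + 1 by omega, show k + d + 1 - (k + 1) = d by omega,
        show k + d + 1 - k = d + 1 by omega, Nat.factorial_succ d, Nat.factorial_succ k]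
      push_cast
      field_simp
      ring
    · simp [Nat.factorial_succ]
      field_simp
      ring
    · rw [if_neg (by omega), if_neg (by omega), if_neg (by omega)]
      simp

/-- The recursion `H_{n+1} = 2X H_n - H_n'` becomes, after the substitution `X²`,
`laguerreL_add_one` at even `n` and `laguerreL_succ` at odd `n`. -/
theorem hermiteH_eq_laguerreL (k : ℕ) :
    hermiteH (2 * k) = ((-1) ^ k * 4 ^ k * k.factorial : ℝ) • (laguerreL (-1 / 2) k).comp (X ^ 2) ∧
    hermiteH (2 * k + 1) =
      ((-1) ^ k * 4 ^ k * k.factorial * 2 : ℝ) • (X * (laguerreL (1 / 2) k).comp (X ^ 2)) := by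
  have hstep : ∀ k, hermiteH (2 * k) =
        ((-1) ^ k * 4 ^ k * k.factorial : ℝ) • (laguerreL (-1 / 2) k).comp (X ^ 2) →
      hermiteH (2 * k + 1) =
        ((-1) ^ k * 4 ^ k * k.factorial * 2 : ℝ) • (X * (laguerreL (1 / 2) k).comp (X ^ 2)) := by
    intro k h
    have h2 := laguerreL_add_one (-1 / 2) k
    rw [show (-1 / 2 : ℝ) + 1 = 1 / 2 by norm_num] at h2
    rw [hermiteH, h, h2, derivative_smul, derivative_comp, mul_smul_comm, ← smul_sub, ← smul_smul _ (2 : ℝ)]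
    congr 1
    simp only [derivative_X_pow, sub_comp, smul_eq_C_mul, map_ofNat, Nat.cast_ofNat]
    ring
  have heven : hermiteH (2 * k) =
      ((-1) ^ k * 4 ^ k * k.factorial : ℝ) • (laguerreL (-1 / 2) k).comp (X ^ 2) := by
    induction k with
    | zero => simp [hermiteH, laguerreL]
    | succ k ih =>
      have h := hstep k ih
      have h3 := congrArg (fun P : ℝ[X] => P.comp (X ^ 2)) (laguerreL_succ (-1 / 2) k)
      simp only [smul_comp, add_comp, sub_comp, mul_comp, X_comp] at h3
      rw [show (-1 / 2 : ℝ) + 1 = 1 / 2 by norm_num] at h3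
      have hc : ((-1) ^ (k + 1) * 4 ^ (k + 1) * (k + 1).factorial : ℝ) =
          (-1) ^ k * 4 ^ k * k.factorial * 2 * (-2) * (k + 1) := by
        rw [Nat.factorial_succ]
        push_cast
        ring
      rw [show 2 * (k + 1) = 2 * k + 1 + 1 by ring, hermiteH, h, hc, ← smul_smul _ (k + 1 : ℝ), h3,
        derivative_smul, mul_smul_comm, ← smul_sub, ← smul_smul _ (-2 : ℝ)]
      congr 1
      generalize laguerreL (1 / 2) k = L
      have hC : (C (1 / 2) : ℝ[X]) * 2 = 1 := by
        rw [← map_ofNat C 2, ← C_mul]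
        norm_num
      simp only [smul_eq_C_mul, derivative_mul, derivative_comp, derivative_X_pow, derivative_X,
        map_ofNat, map_neg, Nat.cast_ofNat]
      linear_combination L.comp (X ^ 2) * hC
  exact ⟨heven, hstep k heven⟩

/-! ### Laguerre functions of parameter `±1/2` at `u²` as Hermite functions -/

theorem Gamma_nat_add_half_mul (k : ℕ) :
    Real.Gamma (k + 1 / 2) * (4 ^ k * k.factorial) = Real.sqrt Real.pi * (2 * k).factorial := by
  induction k with
  | zero => simp [-one_div, Real.Gamma_one_half_eq]
  | succ k ih =>
    have h : ((k + 1 : ℕ) : ℝ) + 1 / 2 = (k + 1 / 2) + 1 := by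
      push_cast
      ring
    rw [h, Real.Gamma_add_one (by positivity), show 2 * (k + 1) = 2 * k + 1 + 1 by ring,
      Nat.factorial_succ, Nat.factorial_succ, Nat.factorial_succ]
    push_cast
    linear_combination (2 * (2 * (k : ℝ) + 1) * (k + 1)) * ih

theorem sqrt_eq_mul_inv_sqrt {A B c : ℝ} (hB : 0 < B) (hc : 0 ≤ c) (h : A * B = c ^ 2) :
    Real.sqrt A = c * (Real.sqrt B)⁻¹ := by
  rw [eq_mul_inv_iff_mul_eq₀ (Real.sqrt_pos.2 hB).ne', ← Real.sqrt_mul' A hB.le, h,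
    Real.sqrt_sq hc]

/-- The alternating sign in `parityHermite` absorbs the `(-1)^k` between Hermite and Laguerre
polynomials; the half-integer Gamma values match the normalizations. -/
theorem laguerreFun_sq_neg_half (k : ℕ) {u : ℝ} (hu : 0 < u) :
    laguerreFun (-1 / 2) k (u ^ 2) =
      u ^ (-1 / 2 : ℝ) * (Real.exp (-(u ^ 2) / 2) * (parityHermite 0 k).eval u) := by
  have hG := Gamma_nat_add_half_mul k
  have hG0 : 0 < Real.Gamma (k + 1 / 2) := Real.Gamma_pos_of_pos (by positivity)
  have hs : Real.sqrt (k.factorial / Real.Gamma (k + -1 / 2 + 1)) =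
      4 ^ k * k.factorial * (Real.sqrt (Real.sqrt Real.pi * 2 ^ (2 * k) * (2 * k).factorial))⁻¹ := by
    rw [show (k : ℝ) + -1 / 2 + 1 = k + 1 / 2 by ring]
    refine sqrt_eq_mul_inv_sqrt (by positivity) (by positivity) ?_
    rw [mul_right_comm, ← hG, pow_mul]
    field_simp
    norm_num
  have hp : (u ^ 2) ^ (-1 / 2 / 2 : ℝ) = u ^ (-1 / 2 : ℝ) := by
    rw [← Real.rpow_natCast, ← Real.rpow_mul hu.le]
    norm_num
  have h1 : ((-1 : ℝ) ^ k) * (-1) ^ k = 1 := by rw [← mul_pow]; simp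
  rw [laguerreFun, indicator_of_mem (mem_Ici.2 (sq_nonneg u)), hs, hp, parityHermite, normedHermite,
    add_zero, (hermiteH_eq_laguerreL k).1]
  simp only [eval_smul, eval_comp, eval_pow, eval_X, smul_eq_mul]
  linear_combination (-(4 ^ k * k.factorial *
    (Real.sqrt (Real.sqrt Real.pi * 2 ^ (2 * k) * (2 * k).factorial))⁻¹ * u ^ (-1 / 2 : ℝ) *
    Real.exp (-(u ^ 2) / 2) * eval (u ^ 2) (laguerreL (-1 / 2) k))) * h1

theorem laguerreFun_sq_half (k : ℕ) {u : ℝ} (hu : 0 < u) :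
    laguerreFun (1 / 2) k (u ^ 2) =
      u ^ (-1 / 2 : ℝ) * (Real.exp (-(u ^ 2) / 2) * (parityHermite 1 k).eval u) := by
  have hG := Gamma_nat_add_half_mul k
  have hG0 : 0 < Real.Gamma (k + 1 / 2) := Real.Gamma_pos_of_pos (by positivity)
  have hs : Real.sqrt (k.factorial / Real.Gamma (k + 1 / 2 + 1)) =
      4 ^ k * k.factorial * 2 *
        (Real.sqrt (Real.sqrt Real.pi * 2 ^ (2 * k + 1) * (2 * k + 1).factorial))⁻¹ := by
    rw [Real.Gamma_add_one (by positivity)]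
    refine sqrt_eq_mul_inv_sqrt (by positivity) (by positivity) ?_
    have h4 : Real.sqrt Real.pi * 2 ^ (2 * k + 1) * (2 * k + 1).factorial =
        Real.Gamma (k + 1 / 2) * (4 ^ k * k.factorial) * (2 * 4 ^ k * (2 * k + 1)) := by
      rw [hG, Nat.factorial_succ, pow_succ, pow_mul]
      push_cast
      norm_num
      ring
    rw [h4]
    field_simp
  have hp : (u ^ 2) ^ (1 / 2 / 2 : ℝ) = u ^ (-1 / 2 : ℝ) * u := by
    rw [← Real.rpow_add_one hu.ne', ← Real.rpow_natCast, ← Real.rpow_mul hu.le]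
    norm_num
  have h1 : ((-1 : ℝ) ^ k) * (-1) ^ k = 1 := by rw [← mul_pow]; simp
  rw [laguerreFun, indicator_of_mem (mem_Ici.2 (sq_nonneg u)), hs, hp, parityHermite, normedHermite,
    (hermiteH_eq_laguerreL k).2]
  simp only [eval_smul, eval_comp, eval_pow, eval_X, eval_mul, smul_eq_mul]
  linear_combination (-(4 ^ k * k.factorial * 2 *
    (Real.sqrt (Real.sqrt Real.pi * 2 ^ (2 * k + 1) * (2 * k + 1).factorial))⁻¹ *
    u ^ (-1 / 2 : ℝ) * u *
    Real.exp (-(u ^ 2) / 2) * eval (u ^ 2) (laguerreL (1 / 2) k))) * h1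

/-- Under `x = u²` the Jacobian `2u` cancels the two factors `u^{-1/2}`, up to the constant 2. -/
theorem setIntegral_Ioi_sq_laguerreFun_mul {a : ℝ} {ε : ℕ}
    (h : ∀ (k : ℕ) (u : ℝ), 0 < u → laguerreFun a k (u ^ 2) =
      u ^ (-1 / 2 : ℝ) * (Real.exp (-(u ^ 2) / 2) * (parityHermite ε k).eval u))
    {r : ℝ} (hr : 0 ≤ r) (j k : ℕ) :
    ∫ x in Ioi (r ^ 2), laguerreFun a j x * laguerreFun a k x =
      2 * gaussMomentOn (Ioi r) (parityHermite ε j * parityHermite ε k) := by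
  have hs := integral_comp_rpow_Ioi_of_pos' (g := fun x => laguerreFun a j x * laguerreFun a k x)
    (two_pos : (0 : ℝ) < 2) (sq_nonneg r)
  rw [← hs, ← Real.rpow_natCast, ← Real.rpow_mul hr, gaussMomentOn_apply, ← integral_const_mul]
  norm_num
  refine setIntegral_congr_fun measurableSet_Ioi fun u hu => ?_
  have hu : 0 < u := hr.trans_lt hu
  have hp : u ^ (-1 / 2 : ℝ) * u ^ (-1 / 2 : ℝ) * u = 1 := by
    rw [← Real.rpow_add hu, ← Real.rpow_add_one hu.ne']
    norm_num
  simp only [h j u hu, h k u hu, ← exp_neg_sq_half_mul_self]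
  linear_combination (2 * (Real.exp (-(u ^ 2) / 2) * Real.exp (-(u ^ 2) / 2) *
    ((parityHermite ε j).eval u * (parityHermite ε k).eval u))) * hp

/-! ### Fredholm determinants of compressions to the span of an orthonormal family -/

theorem inner_toLp_toLp {f g : ℝ → ℝ} (hf : MemLp f 2) (hg : MemLp g 2) :
    inner ℝ (hf.toLp f) (hg.toLp g) = ∫ x, f x * g x := by
  rw [L2.inner_def]
  refine integral_congr_ae ?_
  filter_upwards [hf.coeFn_toLp, hg.coeFn_toLp] with x h1 h2
  simp [h1, h2, mul_comm]

/-- With `K` the projection, `-K A K` is the sum of `⟪f k, ·⟫ (-K A f k)`; orthonormality drops the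
outer `K` from the pairings with `f j`. -/
theorem hasFredholmDet_one_sub_kernelOp {f : ℕ → ℝ → ℝ} (hf : ∀ k, MemLp (f k) 2)
    (horth : ∀ j k, ∫ x, f j x * f k x = if j = k then 1 else 0) (n : ℕ) (A : L2R →L[ℝ] L2R)
    (M : Matrix (Fin n) (Fin n) ℝ) (hM : ∀ j k, M j k = (if j = k then 1 else 0) -
      inner ℝ ((hf j).toLp (f j)) (A ((hf k).toLp (f k)))) :
    HasFredholmDet (1 - kernelOp f hf n * A * kernelOp f hf n) M.det := by
  have hK : ∀ x, kernelOp f hf n x =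
      ∑ k : Fin n, inner ℝ ((hf k).toLp (f k)) x • (hf k).toLp (f k) := by
    intro x
    rw [kernelOp, ← Finset.sum_range fun k => inner ℝ ((hf k).toLp (f k)) x • (hf k).toLp (f k)]
    simp [InnerProductSpace.rankOne_apply]
  convert hasFredholmDet_of_finite_rank (fun k : Fin n => (hf k).toLp (f k))
    (fun k : Fin n => -kernelOp f hf n (A ((hf k).toLp (f k))))
    (1 - kernelOp f hf n * A * kernelOp f hf n) (fun x => ?_) using 2
  · ext j k
    rw [hM, Matrix.add_apply, Matrix.of_apply, inner_neg_right, hK, inner_sum,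
      Matrix.one_apply, sub_eq_add_neg]
    congr 2
    simp only [inner_smul_right, inner_toLp_toLp, horth]
    simp [Fin.val_inj]
  · have : (kernelOp f hf n * A * kernelOp f hf n) x =
        kernelOp f hf n (A (kernelOp f hf n x)) := rfl
    rw [sub_apply, this, hK x, map_sum, map_sum]
    simp [sub_eq_add_neg]

theorem inner_toLp_chiOp {f g : ℝ → ℝ} (hf : MemLp f 2) (hg : MemLp g 2) (r : ℝ) :
    inner ℝ (hf.toLp f) (chiOp r (hg.toLp g)) = ∫ x in Ioi r, f x * g x := by
  rw [L2.inner_def, ← integral_indicator measurableSet_Ioi]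
  refine integral_congr_ae ?_
  filter_upwards [hf.coeFn_toLp, hg.coeFn_toLp,
    contractionOp_apply (chiFun r) (chiFun_contraction r) (hg.toLp g)] with x h1 h2 h3
  rw [chiOp, h3, h1]
  by_cases hx : x ∈ Ioi r
  · simp [chiFun, indicator_of_mem hx, h2, mul_comm]
  · simp [chiFun, indicator_of_notMem hx]

theorem inner_toLp_reflectedOp {f g : ℝ → ℝ} (hf : MemLp f 2) (hg : MemLp g 2) (r : ℝ)
    (hr : 0 ≤ r) :
    inner ℝ (hf.toLp f) (reflectedOp r hr (hg.toLp g)) =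
      ∫ x in Ioi r, f x * (Real.exp (-r * x) * (Real.exp (r * (2 * r - x)) * g (2 * r - x))) := by
  -- The cutoff keeps arguments `≤ r`, which reflect to the closed half-line `x ≥ r`; the endpoint
  -- is null.
  rw [L2.inner_def, ← integral_Ici_eq_integral_Ioi, ← integral_indicator measurableSet_Ici]
  refine integral_congr_ae ?_
  have hmp : MeasurePreserving (fun x : ℝ => 2 * r - x) volume volume :=
    Measure.measurePreserving_sub_left volume (2 * r)
  filter_upwards [hf.coeFn_toLp, hmp.quasiMeasurePreserving.ae_eq_comp hg.coeFn_toLp,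
    contractionOp_apply (reflectedFun r) (reflectedFun_contraction r hr) (hg.toLp g)] with x h1 h2 h3
  rw [reflectedOp, h3, h1]
  simp only [Function.comp_apply] at h2
  by_cases hx : r ≤ x
  · have : ¬ (r < 2 * r - x) := by linarith
    simp [reflectedFun, expMulFun, reflFun, chiBarFun, chiFun, indicator, hx, this, h2, mul_comm (f x)]
  · have : r < 2 * r - x := by linarith
    simp [reflectedFun, expMulFun, reflFun, chiBarFun, chiFun, indicator, hx, this]

/-! ### The two determinants -/

theorem hermiteFun_mul_hermiteFun (j k : ℕ) (x : ℝ) :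
    hermiteFun j x * hermiteFun k x =
      Real.exp (-(x ^ 2)) * (normedHermite j * normedHermite k).eval x := by
  rw [hermiteFun_eq, hermiteFun_eq, eval_mul, ← exp_neg_sq_half_mul_self]
  ring

/-- The conjugation by exponentials exactly compensates the shift of the Gaussian, restoring the
weight `e^{-x²}`. -/
theorem hermiteFun_mul_reflected (r : ℝ) (j k : ℕ) (x : ℝ) :
    hermiteFun j x *
        (Real.exp (-r * x) * (Real.exp (r * (2 * r - x)) * hermiteFun k (2 * r - x))) =
      Real.exp (-(x ^ 2)) * (normedHermite j * (normedHermite k).comp (C (2 * r) - X)).eval x := by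
  have h : Real.exp (-(x ^ 2) / 2) * (Real.exp (-r * x) * (Real.exp (r * (2 * r - x)) *
      Real.exp (-((2 * r - x) ^ 2) / 2))) = Real.exp (-(x ^ 2)) := by
    rw [← Real.exp_add, ← Real.exp_add, ← Real.exp_add]
    ring_nf
  rw [hermiteFun_eq, hermiteFun_eq, ← h]
  simp only [eval_mul, eval_comp, eval_sub, eval_C, eval_X]
  ring

theorem hasFredholmDet_hermiteOp (N : ℕ) (r : ℝ) (hr : 0 ≤ r) :
    HasFredholmDet
      (1 - hermiteOp N * chiOp r * hermiteOp N - hermiteOp N * reflectedOp r hr * hermiteOp N)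
      (Matrix.of fun i j : Fin N => reflectedForm r (normedHermite i) (normedHermite j)).det := by
  have hop : (1 - hermiteOp N * chiOp r * hermiteOp N - hermiteOp N * reflectedOp r hr * hermiteOp N)
      = 1 - hermiteOp N * (chiOp r + reflectedOp r hr) * hermiteOp N := by noncomm_ring
  rw [hop]
  refine hasFredholmDet_one_sub_kernelOp memLp_hermiteFun (fun j k => ?_) N _ _ fun j k => ?_
  · simp only [hermiteFun_mul_hermiteFun]
    rw [← gaussMoment_apply, gaussMoment_normedHermite_mul]
  rw [Matrix.of_apply, reflectedForm_apply, gaussMoment_normedHermite_mul, add_apply, inner_add_right,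
    inner_toLp_chiOp, inner_toLp_reflectedOp]
  simp only [hermiteFun_mul_hermiteFun, hermiteFun_mul_reflected, gaussMomentOn_apply, Fin.val_inj]
  ring

theorem hasFredholmDet_laguerreOp {a : ℝ} (ha : -1 < a) {ε : ℕ}
    (h : ∀ (k : ℕ) (u : ℝ), 0 < u → laguerreFun a k (u ^ 2) =
      u ^ (-1 / 2 : ℝ) * (Real.exp (-(u ^ 2) / 2) * (parityHermite ε k).eval u))
    (m : ℕ) {r : ℝ} (hr : 0 ≤ r) :
    HasFredholmDet (1 - laguerreOp m a ha * chiOp (r ^ 2) * laguerreOp m a ha)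
      (Matrix.of fun i j : Fin m =>
        signedGaussMoment r (parityHermite ε i * parityHermite ε j)).det := by
  have hpar : ∀ j k, (parityHermite ε j * parityHermite ε k).comp (-X) =
      parityHermite ε j * parityHermite ε k := by
    intro j k
    simp only [parityHermite, normedHermite, mul_comp, smul_comp, hermiteH_comp_neg_X]
    have h1 : ((-1 : ℝ[X]) ^ (2 * j + ε)) * (-1) ^ (2 * k + ε) = 1 := by
      rw [← pow_add]
      exact Even.neg_one_pow ⟨j + k + ε, by ring⟩
    simp only [smul_eq_C_mul]
    linear_combination (C ((-1) ^ j) * (C (Real.sqrt (Real.sqrt Real.pi * 2 ^ (2 * j + ε) *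
      (2 * j + ε).factorial))⁻¹ * hermiteH (2 * j + ε)) * (C ((-1) ^ k) *
      (C (Real.sqrt (Real.sqrt Real.pi * 2 ^ (2 * k + ε) *
      (2 * k + ε).factorial))⁻¹ * hermiteH (2 * k + ε)))) * h1
  -- Orthonormality is the case `r = 0` of the substitution: the product is even, so twice its
  -- half-line moment is the full Gauss moment.
  have horth : ∀ j k, ∫ x, laguerreFun a j x * laguerreFun a k x = if j = k then 1 else 0 := by
    intro j k
    have h0 := setIntegral_Ioi_sq_laguerreFun_mul h le_rfl j k
    have h1 := signedGaussMoment_zero_of_even (hpar j k)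
    rw [signedGaussMoment_apply, gaussMoment_parityHermite_mul, ← h0] at h1
    rw [sub_eq_zero.1 h1, zero_pow two_ne_zero, ← integral_Ici_eq_integral_Ioi,
      ← integral_indicator measurableSet_Ici]
    refine integral_congr_ae (Filter.Eventually.of_forall fun x => ?_)
    by_cases hx : x ∈ Ici (0 : ℝ)
    · simp [indicator_of_mem hx]
    · simp [indicator_of_notMem hx, laguerreFun]
  refine hasFredholmDet_one_sub_kernelOp (memLp_laguerreFun a ha) horth m (chiOp (r ^ 2)) _
    fun j k => ?_
  rw [Matrix.of_apply, inner_toLp_chiOp, setIntegral_Ioi_sq_laguerreFun_mul h hr, signedGaussMoment_apply,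
    gaussMoment_parityHermite_mul]
  simp only [Fin.val_inj]

end

theorem proposition3p1 (N : ℕ) (r : ℝ) (hr : 0 ≤ r) :
    ∃ U : ℝ,
      HasFredholmDet
        (1 - hermiteOp N * chiOp r * hermiteOp N
          - hermiteOp N * reflectedOp r hr * hermiteOp N) U ∧
      HasFredholmDet
        (1 - laguerreOp ((N + 1) / 2) (1 / 2 * (-1) ^ N) (neg_one_lt_half_neg_one_pow N)
          * chiOp (r ^ 2)
          * laguerreOp ((N + 1) / 2) (1 / 2 * (-1) ^ N) (neg_one_lt_half_neg_one_pow N)) U := by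
  refine ⟨_, hasFredholmDet_hermiteOp N r hr, ?_⟩
  -- The parity `ε` is that of `N - 1`: even `N` needs the odd Hermite functions, with `a = 1/2`,
  -- and odd `N` the even ones.
  rcases Nat.even_or_odd N with hN | hN
  · have ha : (1 / 2 * (-1) ^ N : ℝ) = 1 / 2 := by rw [hN.neg_one_pow, mul_one]
    rw [det_reflectedForm_eq le_rfl (m := (N + 1) / 2) (by grind) r]
    exact hasFredholmDet_laguerreOp _
      (fun k u hu => by rw [ha]; exact laguerreFun_sq_half k hu) _ hr
  · have ha : (1 / 2 * (-1) ^ N : ℝ) = -1 / 2 := by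
      rw [hN.neg_one_pow]
      norm_num
    rw [det_reflectedForm_eq zero_le_one (m := (N + 1) / 2) (by grind) r]
    exact hasFredholmDet_laguerreOp _
      (fun k u hu => by rw [ha]; exact laguerreFun_sq_neg_half k hu) _ hr
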